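/- Let $(M,\rho,\mu)$ be a space of homogeneous type: $\rho$ is a quasi-metric on $M$, $\mu$ is a measure on a $\sigma$-algebra containing the $\rho$-open sets and the balls, every ball of positive radius has finite positive measure, and $\mu$ is doubling. Assume that $\mu$ is $\sigma$-finite and $\mu(M)=\infty$. Let $1<q<\infty$. A $(1,q)$-atom is a function $a\in L^q(M)$ that is supported in a closed ball $B=\{y:\rho(x,y)\le r\}$, $r>0$, with $\int_M a\,d\mu=0$ and $\bigl(\mu(B)^{-1}\int_B|a|^q\,d\mu\bigr)^{1/q}\le\mu(B)^{-1}$. Let $H^{1,q}_{\mathrm{fin}}(M)$ be the space of all finite complex linear combinations of $(1,q)$-atoms. Let $H^1(M)=H^{1,q}(M)$ be the space of all $g\in L^1(M)$ of the form $g=\sum_{j}\lambda_j a_j$ with $(1,q)$-atoms $a_j$ and complex numbers $\lambda_j$ with $\sum_j|\lambda_j|<\infty$, and let $\|g\|_{H^1}$ be the infimum of $\sum_j|\lambda_j|$ over all such representations. Let $T:H^{1,q}_{\mathrm{fin}}(M)\to L^1(M)$ be a linear operator with $$A:=\sup\{\|Ta\|_{L^1(M)} : a \text{ is a } (1,q)\text{-atom}\}<\infty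 .$$ Then there is a unique bounded linear operator $\widetilde T:H^1(M)\to L^1(M)$ that extends $T$, and $\|\widetilde Tg\|_{L^1(M)}\le 2A\,\|g\|_{H^1}$ for all $g\in H^1(M)$. -/

import Mathlib

open MeasureTheory
open scoped ENNReal

namespace AtomicHardy

variable {M : Type*}

/-- `ρ` is a quasi-metric on `M` (the triangle inequality holds up to a factor `K`). -/
structure IsQuasiMetric (ρ : M → M → ℝ) : Prop where
  nonneg : ∀ x y, 0 ≤ ρ x y
  eq_zero_iff : ∀ x y, ρ x y = 0 ↔ x = y
  symm : ∀ x y, ρ x y = ρ y x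
  triangle : ∃ K : ℝ, ∀ x y z, ρ x z ≤ K * (ρ x y + ρ y z)

/-- The closed ball of centre `x` and radius `r` for `ρ`. -/
def cball (ρ : M → M → ℝ) (x : M) (r : ℝ) : Set M := {y | ρ x y ≤ r}

/-- `(M, ρ, μ)` is a space of homogeneous type: `ρ` is a quasi-metric, the sets that are open for
`ρ` and the balls are measurable, balls have positive finite measure, and `μ` is doubling.
(Measurability and doubling for all closed balls of positive radius is the same as for
all open balls, up to the doubling constant.) -/
structure IsHomogeneousType [MeasurableSpace M] (ρ : M → M → ℝ) (μ : Measure M) : Prop where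
  quasiMetric : IsQuasiMetric ρ
  measurableSet_open : ∀ U : Set M, (∀ x ∈ U, ∃ r > 0, cball ρ x r ⊆ U) → MeasurableSet U
  measurableSet_cball : ∀ x r, 0 < r → MeasurableSet (cball ρ x r)
  measure_pos : ∀ x r, 0 < r → 0 < μ (cball ρ x r)
  measure_lt_top : ∀ x r, 0 < r → μ (cball ρ x r) < ∞
  doubling : ∃ D : ℝ, ∀ x r, 0 < r → μ (cball ρ x (2 * r)) ≤ ENNReal.ofReal D * μ (cball ρ x r)

variable [MeasurableSpace M]

/-- `a` is a `(1,q)`-atom, `1 < q ≤ ∞`: it is in `L^q`, and for some ball `B` it vanishes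
(almost everywhere) outside `B`, it has integral zero, and its `L^q` norm with respect to the
normalized measure `μ(B)⁻¹ μ` on `B` is at most `μ(B)⁻¹`. Functions are identified when they agree
almost everywhere; such an `a` is always integrable, so atoms are taken as elements of `L^1`. -/
def IsAtom (ρ : M → M → ℝ) (μ : Measure M) (q : ℝ≥0∞) (a : Lp ℂ 1 μ) : Prop :=
  MemLp a q μ ∧ ∃ (x : M) (r : ℝ), 0 < r ∧
    (∀ᵐ y ∂μ, y ∉ cball ρ x r → a y = 0) ∧
    ∫ y, a y ∂μ = 0 ∧
    eLpNorm a q ((μ (cball ρ x r))⁻¹ • μ.restrict (cball ρ x r)) ≤ (μ (cball ρ x r))⁻¹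

/-- `H^{1,q}_fin(M)`: the space of all finite linear combinations of `(1,q)`-atoms. -/
noncomputable def Hfin (ρ : M → M → ℝ) (μ : Measure M) (q : ℝ≥0∞) : Submodule ℂ (Lp ℂ 1 μ) :=
  Submodule.span ℂ {a | IsAtom ρ μ q a}

/-- `g = ∑ j, c j • a j` with `(1,q)`-atoms `a j` and `∑ j, |c j| < ∞`. (The atoms have `L^1` norm
at most one, so that the series converges absolutely in `L^1`.) -/
structure IsAtomicDecomp (ρ : M → M → ℝ) (μ : Measure M) (q : ℝ≥0∞) (g : Lp ℂ 1 μ)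
    (c : ℕ → ℂ) (a : ℕ → Lp ℂ 1 μ) : Prop where
  atom : ∀ j, IsAtom ρ μ q (a j)
  summable : Summable fun j => ‖c j‖
  hasSum : HasSum (fun j => c j • a j) g

theorem isAtom_zero [Nonempty M] (ρ : M → M → ℝ) (μ : Measure M) (q : ℝ≥0∞) :
    IsAtom ρ μ q 0 := by
  have h := Lp.coeFn_zero ℂ 1 μ
  refine ⟨(MemLp.zero (ε := ℂ)).ae_eq h.symm, Classical.arbitrary M, 1, one_pos, ?_, ?_, ?_⟩
  · filter_upwards [h] with y hy _
    simpa using hy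
  · rw [integral_congr_ae h]; simp
  · have h' : ⇑(0 : Lp ℂ 1 μ) =ᵐ[(μ (cball ρ (Classical.arbitrary M) 1))⁻¹ •
        μ.restrict (cball ρ (Classical.arbitrary M) 1)] 0 :=
      Measure.ae_smul_measure (ae_restrict_of_ae h) _
    rw [eLpNorm_congr_ae h']
    simp

/-- The Hardy space `H^{1,q}(M)`: all `g` in `L^1` with an atomic decomposition. -/
noncomputable def H1 [Nonempty M] (ρ : M → M → ℝ) (μ : Measure M) (q : ℝ≥0∞) : Submodule ℂ (Lp ℂ 1 μ) where
  carrier := {g | ∃ c a, IsAtomicDecomp ρ μ q g c a}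
  zero_mem' := ⟨0, 0, fun _ => isAtom_zero ρ μ q, by simp, by simp⟩
  add_mem' := by
    rintro g g' ⟨c, a, h⟩ ⟨c', a', h'⟩
    let e : ℕ ≃ ℕ ⊕ ℕ := Equiv.natSumNatEquivNat.symm
    refine ⟨Sum.elim c c' ∘ e, Sum.elim a a' ∘ e, fun j => ?_, ?_, ?_⟩
    · rcases hj : e j with i | i
      · simpa [hj] using h.atom i
      · simpa [hj] using h'.atom i
    · exact (e.summable_iff (f := fun s => ‖Sum.elim c c' s‖)).2
        (HasSum.sum (f := fun s => ‖Sum.elim c c' s‖) h.summable.hasSum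
          h'.summable.hasSum).summable
    · exact (e.hasSum_iff (f := fun s => Sum.elim c c' s • Sum.elim a a' s)).2
        (HasSum.sum (f := fun s => Sum.elim c c' s • Sum.elim a a' s) h.hasSum h'.hasSum)
  smul_mem' := by
    rintro z g ⟨c, a, h⟩
    refine ⟨fun j => z * c j, a, h.atom, ?_, ?_⟩
    · simpa using h.summable.mul_left ‖z‖
    · simpa [mul_smul] using h.hasSum.const_smul z

/-- The norm of `H^{1,q}(M)`: the infimum of `∑ j, |c j|` over all atomic decompositions. -/
noncomputable def h1Norm (ρ : M → M → ℝ) (μ : Measure M) (q : ℝ≥0∞) (g : Lp ℂ 1 μ) : ℝ :=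
  sInf {s | ∃ c a, IsAtomicDecomp ρ μ q g c a ∧ s = ∑' j, ‖c j‖}

theorem Hfin_le_H1 [Nonempty M] (ρ : M → M → ℝ) (μ : Measure M) (q : ℝ≥0∞) :
    Hfin ρ μ q ≤ H1 ρ μ q := by
  refine Submodule.span_le.2 fun b hb => ?_
  refine ⟨Pi.single 0 1, fun _ => b, fun _ => hb, ?_, ?_⟩
  · refine summable_of_ne_finset_zero (s := {0}) fun j hj => ?_
    simp [Pi.single_eq_of_ne (Finset.notMem_singleton.1 hj)]
  · have := hasSum_single (f := fun j : ℕ => (Pi.single 0 1 : ℕ → ℂ) j • b) 0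
      (fun j hj => by simp [Pi.single_eq_of_ne hj])
    simpa using this

/-- `S` is bounded from `H^{1,q}(M)` to `L^1(M)` and extends `T`. -/
def IsBoundedExtension [Nonempty M] (ρ : M → M → ℝ) (μ : Measure M) (q : ℝ≥0∞)
    (T : Hfin ρ μ q →ₗ[ℂ] Lp ℂ 1 μ) (S : H1 ρ μ q →ₗ[ℂ] Lp ℂ 1 μ) : Prop :=
  (∃ C : ℝ, ∀ g, ‖S g‖ ≤ C * h1Norm ρ μ q g) ∧
    S ∘ₗ Submodule.inclusion (Hfin_le_H1 ρ μ q) = T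

/-- The set of all `‖T a‖` in `L^1`, for `(1,q)`-atoms `a`. -/
def atomNorms (ρ : M → M → ℝ) (μ : Measure M) (q : ℝ≥0∞)
    (T : Hfin ρ μ q →ₗ[ℂ] Lp ℂ 1 μ) : Set ℝ :=
  {s | ∃ a : Hfin ρ μ q, IsAtom ρ μ q a ∧ s = ‖T a‖}

end AtomicHardy

/-!
Let `q` and `p` be conjugate exponents. The point of the proof is the estimate
`‖T g‖ ≤ 2 A ∑ |c j|` for every `g` in `Hfin` and *every* atomic decomposition `g = ∑ c j • a j`,
finite or not (`norm_map_le_of_decomp`). It is not obvious, since the series converges in `L^1` and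
`T` is not assumed to be continuous there.

By Hahn-Banach it suffices to treat a linear functional `ℓ` on `Hfin` with `|ℓ a| ≤ A` on atoms.
A multiple of each mean-zero `L^q` function supported in a ball is an atom, so `ℓ` is bounded on the
mean-zero part of `L^q` of each ball. The Riesz representation theorem on an exhausting sequence of
balls, together with a gluing argument, provides a function `b`, locally in `L^p`, such that
`ℓ g = ∫ b g` for all `g` in `Hfin` (`exists_apply_eq_integral_mul`). Testing with mean-zero
functions on a ball bounds the `L^p` oscillation of `b` on that ball by `2 A`
(`eLpNorm_sub_average_le`): `b` has bounded mean oscillation. Truncating `b` at height `N` is a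
contraction, so the truncations `b_N` inherit the bound, whence `|∫ b_N a| ≤ 2 A` for all atoms `a`
(`enorm_integral_mul_atom_le`). Since `b_N` is bounded, `∫ b_N g = ∑ c j ∫ b_N (a j)`, which is at
most `2 A ∑ |c j|`, and dominated convergence as `N → ∞` yields the bound for `ℓ g = ∫ b g`
(`norm_apply_le_of_decomp`).

Applied to the tails of a decomposition, the estimate shows that `T g = ∑ c j • T (a j)`
(`hasSum_apply_atoms`). Hence `∑ c j • T (a j)` depends only on `∑ c j • a j`, and
it defines the extension to `H1` (`exists_extension`). A bounded extension has to be given by this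
formula (`IsBoundedExtension.hasSum`), so it is unique, and the formula bounds its norm by `A`.

The representation of functionals on `L^q` of a finite measure
(`exists_forall_apply_eq_integral_mul`) is derived from the Radon-Nikodym theorem for complex
measures and the converse of Hölder's inequality.
-/

namespace AtomicHardy

open Filter Topology ProbabilityTheory

/-! ### The dual of `L^q` of a finite measure -/

/-- Pointwise identities for `conj z * |z| ^ (p - 2)`, the test function for which Hölder's
inequality against `z` is an equality. They hold at `z = 0` too, although `0 ^ (p - 2)` may be a
negative power. -/
theorem mul_extremal_and_norm_extremal (p : ℝ) (hp : 1 < p) (z : ℂ) :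
    z * ((starRingEnd ℂ) z * ((‖z‖ ^ (p - 2) : ℝ) : ℂ)) = ((‖z‖ ^ p : ℝ) : ℂ) ∧
    ‖(starRingEnd ℂ) z * ((‖z‖ ^ (p - 2) : ℝ) : ℂ)‖ = ‖z‖ ^ (p - 1) := by
  rcases eq_or_ne z 0 with rfl | hz
  · have h1 : p ≠ 0 := by linarith
    have h2 : p - 1 ≠ 0 := by linarith
    simp [Real.zero_rpow, h1, h2]
  · have h0 : 0 < ‖z‖ := norm_pos_iff.2 hz
    constructor
    · rw [← mul_assoc, Complex.mul_conj, Complex.normSq_eq_norm_sq, ← Complex.ofReal_mul,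
        ← Real.rpow_natCast, ← Real.rpow_add h0]
      norm_num
    · rw [norm_mul, RCLike.norm_conj, Complex.norm_real, Real.norm_of_nonneg (by positivity)]
      nth_rewrite 1 [← Real.rpow_one ‖z‖]
      rw [← Real.rpow_add h0]
      ring_nf

/-- The converse of Hölder's inequality for bounded `b`. Boundedness makes `∫ |b| ^ p` finite, so
that one may divide by its power `1 / q`. The test functions needed vanish where `b` does; this
matters when the statement is applied to the restriction of a function to a set. -/
theorem eLpNorm_le_of_integral_mul_le_of_bounded {α : Type*} [MeasurableSpace α] {ν : Measure α}
    [IsFiniteMeasure ν] {p q : ℝ≥0∞} [hpq : ENNReal.HolderConjugate p q] (hq : 1 < q) (hq' : q < ∞)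
    {b : α → ℂ} (hbm : Measurable b) {C : ℝ} (hbC : ∀ y, ‖b y‖ ≤ C) {D : ℝ≥0∞}
    (h : ∀ φ : α → ℂ, Measurable φ → (∃ C : ℝ, ∀ y, ‖φ y‖ ≤ C) → (∀ y, b y = 0 → φ y = 0) →
      ‖∫ y, b y * φ y ∂ν‖ₑ ≤ D * eLpNorm φ q ν) :
    eLpNorm b p ν ≤ D := by
  have hp : 1 < p := (ENNReal.HolderConjugate.lt_top_iff_one_lt q p).1 hq'
  have hp' : p < ∞ := (ENNReal.HolderConjugate.lt_top_iff_one_lt p q).2 hq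
  have hc : p.toReal.HolderConjugate q.toReal :=
    ENNReal.HolderConjugate.toReal_of_ne_top hp'.ne hq'.ne
  set P := p.toReal
  set Q := q.toReal
  have hP : 1 < P := hc.lt
  set φ : α → ℂ := fun y => (starRingEnd ℂ) (b y) * ((‖b y‖ ^ (P - 2) : ℝ) : ℂ) with hφ
  have hφm : Measurable φ := by
    have h1 : Measurable fun y => (starRingEnd ℂ) (b y) :=
      Complex.continuous_conj.measurable.comp hbm
    fun_prop
  have hC : ∀ y, ‖φ y‖ ≤ |C| ^ (P - 1) := fun y => by
    rw [hφ, (mul_extremal_and_norm_extremal P hP (b y)).2]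
    exact Real.rpow_le_rpow (norm_nonneg _) ((hbC y).trans (le_abs_self C)) (by linarith)
  have key := h φ hφm ⟨_, hC⟩ (fun y hy => by simp [hφ, hy])
  set I := ∫⁻ y, ‖b y‖ₑ ^ P ∂ν with hI
  have hbp : eLpNorm b p ν = I ^ (1 / P) :=
    eLpNorm_eq_lintegral_rpow_enorm_toReal (by positivity) hp'.ne
  have hφq : eLpNorm φ q ν = I ^ (1 / Q) := by
    rw [eLpNorm_eq_lintegral_rpow_enorm_toReal (by positivity) hq'.ne]
    congr 1
    refine lintegral_congr fun y => ?_
    have : ‖φ y‖ₑ = ‖b y‖ₑ ^ (P - 1) := by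
      rw [← ofReal_norm, ← ofReal_norm, (mul_extremal_and_norm_extremal P hP (b y)).2,
        ENNReal.ofReal_rpow_of_nonneg (norm_nonneg _) (by linarith)]
    rw [this, ← ENNReal.rpow_mul, hc.sub_one_mul_conj]
  have hint : ‖∫ y, b y * φ y ∂ν‖ₑ = I := by
    have : ∀ y, b y * φ y = ((‖b y‖ ^ P : ℝ) : ℂ) := fun y =>
      (mul_extremal_and_norm_extremal P hP (b y)).1
    simp_rw [this]
    rw [integral_complex_ofReal, ← ofReal_norm, Complex.norm_real,
      Real.norm_of_nonneg (integral_nonneg fun y => by positivity),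
      ofReal_integral_eq_lintegral_ofReal]
    · refine lintegral_congr fun y => ?_
      rw [← ofReal_norm, ENNReal.ofReal_rpow_of_nonneg (norm_nonneg _) (by linarith)]
    · refine Integrable.of_bound (C := |C| ^ P)
        (hbm.norm.pow_const P).aestronglyMeasurable (.of_forall fun y => ?_)
      rw [Real.norm_of_nonneg (by positivity)]
      exact Real.rpow_le_rpow (norm_nonneg _) ((hbC y).trans (le_abs_self C)) (by linarith)
    · exact .of_forall fun y => by positivity
  have hIfin : I ≠ ∞ := by
    have : MemLp b p ν := MemLp.of_bound hbm.aestronglyMeasurable C (.of_forall hbC)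
    have h2 := this.2
    rw [hbp] at h2
    intro hh
    rw [hh, ENNReal.top_rpow_of_pos (by positivity)] at h2
    exact lt_irrefl _ h2
  rw [hint, hφq] at key
  rw [hbp]
  rcases eq_or_ne I 0 with h0 | h0
  · rw [h0, ENNReal.zero_rpow_of_pos (by positivity)]; simp
  · have e : I = I ^ (1 / P) * I ^ (1 / Q) := by
      rw [← ENNReal.rpow_add _ _ h0 hIfin, one_div, one_div, hc.inv_add_inv_eq_one,
        ENNReal.rpow_one]
    have hne0 : I ^ (1 / Q) ≠ 0 := by simp [ENNReal.rpow_eq_zero_iff, h0, hIfin]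
    have hnet : I ^ (1 / Q) ≠ ∞ := ENNReal.rpow_ne_top_of_nonneg (by positivity) hIfin
    nth_rewrite 1 [e] at key
    exact (ENNReal.mul_le_mul_iff_left hne0 hnet).1 key

/-- The converse of Hölder's inequality: bounded test functions suffice to determine the `L^p` norm,
even if `b` is not known to be in `L^p`. -/
theorem eLpNorm_le_of_integral_mul_le {α : Type*} [MeasurableSpace α] {ν : Measure α}
    [IsFiniteMeasure ν] {p q : ℝ≥0∞} [hpq : ENNReal.HolderConjugate p q] (hq : 1 < q) (hq' : q < ∞)
    {b : α → ℂ} (hb : AEStronglyMeasurable b ν) {D : ℝ≥0∞}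
    (h : ∀ φ : α → ℂ, Measurable φ → (∃ C : ℝ, ∀ y, ‖φ y‖ ≤ C) →
      ‖∫ y, b y * φ y ∂ν‖ₑ ≤ D * eLpNorm φ q ν) :
    eLpNorm b p ν ≤ D := by
  obtain ⟨b', hb', hbb'⟩ := hb
  rw [eLpNorm_congr_ae hbb']
  set f : ℕ → α → ℂ := fun n => {y | ‖b' y‖ ≤ n}.indicator b' with hf
  have hs : ∀ n : ℕ, MeasurableSet {y | ‖b' y‖ ≤ n} := fun n =>
    measurableSet_le hb'.measurable.norm measurable_const
  have hfm : ∀ n, Measurable (f n) := fun n => hb'.measurable.indicator (hs n)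
  have hlim : ∀ y, Tendsto (fun n => f n y) atTop (𝓝 (b' y)) := fun y => by
    obtain ⟨N, hN⟩ := exists_nat_ge ‖b' y‖
    refine tendsto_const_nhds.congr' ?_
    filter_upwards [eventually_ge_atTop N] with n hn
    have : ‖b' y‖ ≤ n := hN.trans (by exact_mod_cast hn)
    simp [hf, this]
  refine (Lp.eLpNorm_lim_le_liminf_eLpNorm (fun n => (hfm n).aestronglyMeasurable) b'
    (.of_forall hlim)).trans ?_
  have hn : ∀ n, eLpNorm (f n) p ν ≤ D := fun n => by
    refine eLpNorm_le_of_integral_mul_le_of_bounded hq hq' (hfm n) (C := n) (fun y => ?_) ?_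
    · by_cases hy : ‖b' y‖ ≤ n <;> simp [hf, hy]
    · intro φ hφ hC h0
      refine le_trans (le_of_eq ?_) (h φ hφ hC)
      congr 1
      refine integral_congr_ae ?_
      filter_upwards [hbb'] with y hy
      rw [hy]
      by_cases hyn : ‖b' y‖ ≤ n
      · simp [hf, hyn]
      · have : φ y = 0 := h0 y (by simp [hf, hyn])
        simp [this]
  exact (liminf_le_liminf (.of_forall hn)).trans (by simp)

/-- The complex measure `E ↦ Λ 1_E` of a functional `Λ` on `L^q` of a finite measure, with the value
`0` on sets that are not measurable. It is countably additive because `q < ∞`. -/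
noncomputable def indicatorMeasure {α : Type*} [MeasurableSpace α] {ν : Measure α}
    [IsFiniteMeasure ν] {q : ℝ≥0∞} [Fact (1 ≤ q)] (hq' : q ≠ ∞) (Λ : Lp ℂ q ν →L[ℂ] ℂ) :
    ComplexMeasure α where
  measureOf' s := by
    classical
    exact if hs : MeasurableSet s then Λ (indicatorConstLp q hs (measure_ne_top ν s) 1) else 0
  empty' := by simp
  not_measurable' s hs := by simp [hs]
  m_iUnion' f hf hd := by
    simp only [hf, MeasurableSet.iUnion hf, dite_true]
    refine HasSum.mapL Λ ?_
    have hfin : ∀ s : Finset ℕ, MeasurableSet (⋃ i ∈ s, f i) := fun s =>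
      s.measurableSet_biUnion fun i _ => hf i
    have hsum : ∀ s : Finset ℕ, ∑ i ∈ s, indicatorConstLp q (hf i) (measure_ne_top ν (f i)) (1 : ℂ)
        = indicatorConstLp q (hfin s) (measure_ne_top ν _) 1 := fun s => by
      classical
      induction s using Finset.induction_on with
      | empty => simp
      | insert j s hj ih =>
        have hdj : Disjoint (f j) (⋃ i ∈ s, f i) := by
          simp only [Set.disjoint_iUnion_right]
          intro i hi
          exact hd (by rintro rfl; exact hj hi)
        rw [Finset.sum_insert hj, ih,
          ← indicatorConstLp_disjoint_union (hf j) (hfin s) _ _ hdj]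
        congr 1
        simp
    simp only [HasSum, hsum]
    refine tendsto_indicatorConstLp_set hq' ?_
    have h1 : ∑' i, ν (f i) ≠ ∞ := by
      rw [← measure_iUnion hd hf]; exact measure_ne_top _ _
    refine tendsto_of_tendsto_of_tendsto_of_le_of_le tendsto_const_nhds
      (ENNReal.tendsto_tsum_compl_atTop_zero h1) (fun _ => by simp) fun s => ?_
    refine le_trans (measure_mono ?_) (measure_iUnion_le (fun i : {i // i ∉ s} => f i))
    intro y hy
    rcases hy with ⟨h, h'⟩ | ⟨h, h'⟩
    · simp only [Set.mem_iUnion] at h h'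
      obtain ⟨i, _, hi⟩ := h
      exact absurd ⟨i, hi⟩ h'
    · simp only [Set.mem_iUnion, not_exists] at h h'
      obtain ⟨i, hi⟩ := h
      exact Set.mem_iUnion.2 ⟨⟨i, fun hs => h' i hs hi⟩, hi⟩

theorem indicatorMeasure_apply {α : Type*} [MeasurableSpace α] {ν : Measure α}
    [IsFiniteMeasure ν] {q : ℝ≥0∞} [Fact (1 ≤ q)] (hq' : q ≠ ∞) (Λ : Lp ℂ q ν →L[ℂ] ℂ)
    {s : Set α} (hs : MeasurableSet s) :
    indicatorMeasure hq' Λ s = Λ (indicatorConstLp q hs (measure_ne_top ν s) 1) := by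
  classical
  exact dif_pos hs

theorem exists_integrable_forall_indicator {α : Type*} [MeasurableSpace α] {ν : Measure α}
    [IsFiniteMeasure ν] {q : ℝ≥0∞} [Fact (1 ≤ q)] (hq' : q ≠ ∞) (Λ : Lp ℂ q ν →L[ℂ] ℂ) :
    ∃ b : α → ℂ, Integrable b ν ∧ ∀ (s : Set α) (hs : MeasurableSet s),
      Λ (indicatorConstLp q hs (measure_ne_top ν s) 1) = ∫ y in s, b y ∂ν := by
  set c := indicatorMeasure hq' Λ with hc
  have hac : c ≪ᵥ ν.toENNRealVectorMeasure := by
    refine VectorMeasure.AbsolutelyContinuous.mk fun s hs h0 => ?_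
    rw [Measure.toENNRealVectorMeasure_apply_measurable hs] at h0
    rw [hc, indicatorMeasure_apply hq' Λ hs]
    have : indicatorConstLp q hs (measure_ne_top ν s) (1 : ℂ) = 0 := by
      rw [← norm_eq_zero, norm_indicatorConstLp (by have := Fact.out (p := 1 ≤ q); positivity) hq']
      have : 0 < q.toReal :=
        ENNReal.toReal_pos (zero_lt_one.trans_le (Fact.out : 1 ≤ q)).ne' hq'
      simp [Measure.real, h0, this.ne']
    rw [this, map_zero]
  obtain ⟨hre, him⟩ := (ComplexMeasure.absolutelyContinuous_ennreal_iff c _).1 hac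
  refine ⟨c.rnDeriv ν, c.integrable_rnDeriv ν, fun s hs => ?_⟩
  rw [← indicatorMeasure_apply hq' Λ hs, ← hc]
  have hi := (c.integrable_rnDeriv ν).integrableOn (s := s)
  apply Complex.ext
  · rw [← RCLike.re_eq_complex_re, ← integral_re hi]
    change (ComplexMeasure.re c) s = _
    conv_lhs => rw [← SignedMeasure.withDensityᵥ_rnDeriv_eq _ ν hre,
      withDensityᵥ_apply (SignedMeasure.integrable_rnDeriv _ _) hs]
    rfl
  · rw [← RCLike.im_eq_complex_im, ← integral_im hi]
    change (ComplexMeasure.im c) s = _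
    conv_lhs => rw [← SignedMeasure.withDensityᵥ_rnDeriv_eq _ ν him,
      withDensityᵥ_apply (SignedMeasure.integrable_rnDeriv _ _) hs]
    rfl

/-- A functional that is given by integration against an integrable `b` on indicators is so on all
bounded functions. At this stage `b` need not be in `L^p`, so that `L^q` convergence of simple
functions is not enough; they are chosen to converge boundedly too. -/
theorem apply_toLp_eq_integral_mul {α : Type*} [MeasurableSpace α] {ν : Measure α}
    [IsFiniteMeasure ν] {q : ℝ≥0∞} [Fact (1 ≤ q)] (hq' : q ≠ ∞) (Λ : Lp ℂ q ν →L[ℂ] ℂ)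
    {b : α → ℂ} (hb : Integrable b ν) (h : ∀ (s : Set α) (hs : MeasurableSet s),
      Λ (indicatorConstLp q hs (measure_ne_top ν s) 1) = ∫ y in s, b y ∂ν)
    {φ : α → ℂ} (hφ : Measurable φ) {C : ℝ} (hC : ∀ y, ‖φ y‖ ≤ C) (hφq : MemLp φ q ν) :
    Λ (hφq.toLp φ) = ∫ y, b y * φ y ∂ν := by
  have hsimple : ∀ (f : SimpleFunc α ℂ) (hf : MemLp f q ν),
      Λ (hf.toLp f) = ∫ y, b y * f y ∂ν := fun f => by
    have hbd : ∀ g : SimpleFunc α ℂ, Integrable (fun y => b y * g y) ν := fun g => by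
      obtain ⟨C, hC⟩ := g.exists_forall_norm_le
      exact hb.mul_bdd g.aestronglyMeasurable (.of_forall hC)
    have hLq : ∀ g : SimpleFunc α ℂ, MemLp g q ν := fun g => g.memLp_of_isFiniteMeasure q ν
    induction f using SimpleFunc.induction with
    | @const c s hs =>
      intro hf
      have : hf.toLp _ = c • indicatorConstLp q hs (measure_ne_top ν s) (1 : ℂ) := by
        rw [indicatorConstLp, ← MemLp.toLp_const_smul]
        congr 1
        ext y
        by_cases hy : y ∈ s <;> simp [hy]
      rw [this, map_smul, h s hs, ← integral_indicator hs, smul_eq_mul, ← integral_const_mul]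
      refine integral_congr_ae (.of_forall fun y => ?_)
      by_cases hy : y ∈ s <;> simp [hy, mul_comm]
    | @add f g hd hf' hg' =>
      intro hf
      have : hf.toLp _ = (hLq f).toLp f + (hLq g).toLp g := rfl
      rw [this, map_add, hf' (hLq f), hg' (hLq g), ← integral_add (hbd f) (hbd g)]
      simp [mul_add]
  have h1 := (Λ.continuous.tendsto _).comp (SimpleFunc.tendsto_approxOn_range_Lp hq' hφ hφq)
  refine tendsto_nhds_unique h1 ?_
  simp only [Function.comp_def, hsimple]
  refine tendsto_integral_of_dominated_convergence (fun y => ‖b y‖ * (C + C)) (fun n => ?_)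
    (hb.norm.mul_const _) (fun n => .of_forall fun y => ?_) (.of_forall fun y => ?_)
  · exact hb.1.mul (SimpleFunc.aestronglyMeasurable _)
  · rw [norm_mul]
    gcongr
    exact (SimpleFunc.norm_approxOn_zero_le hφ (by simp) y n).trans (add_le_add (hC y) (hC y))
  · exact (SimpleFunc.tendsto_approxOn hφ (by simp) (subset_closure (by simp))).const_mul _

/-- Riesz representation: functionals on `L^q` of a finite measure, `1 < q < ∞`, are given by
integration against functions in `L^p`. -/
theorem exists_forall_apply_eq_integral_mul {α : Type*} [MeasurableSpace α] {ν : Measure α}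
    [IsFiniteMeasure ν] {p q : ℝ≥0∞} [Fact (1 ≤ q)] [hpq : ENNReal.HolderConjugate p q]
    (hq : 1 < q) (hq' : q < ∞) (Λ : Lp ℂ q ν →L[ℂ] ℂ) :
    ∃ b : α → ℂ, MemLp b p ν ∧ ∀ h : Lp ℂ q ν, Λ h = ∫ y, b y * h y ∂ν := by
  obtain ⟨b, hb, hbΛ⟩ := exists_integrable_forall_indicator hq'.ne Λ
  have hbp : MemLp b p ν := by
    refine ⟨hb.1, (eLpNorm_le_of_integral_mul_le hq hq' hb.1 (D := ‖Λ‖ₑ) ?_).trans_lt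
      enorm_lt_top⟩
    rintro φ hφ ⟨C, hC⟩
    have hφq : MemLp φ q ν := MemLp.of_bound hφ.aestronglyMeasurable C (.of_forall hC)
    rw [← apply_toLp_eq_integral_mul hq'.ne Λ hb hbΛ hφ hC hφq, ← Lp.enorm_toLp (hf := hφq)]
    exact Λ.le_opENorm _
  have : Fact (1 ≤ p) := ⟨ENNReal.HolderConjugate.one_le p q⟩
  refine ⟨b, hbp, fun h => ?_⟩
  have e : ∀ h : Lp ℂ q ν, (ContinuousLinearMap.mul ℂ ℂ).lpPairing ν p q (hbp.toLp b) h =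
      ∫ y, b y * h y ∂ν := fun h => by
    rw [ContinuousLinearMap.lpPairing_eq_integral]
    refine integral_congr_ae ?_
    filter_upwards [hbp.coeFn_toLp] with y hy
    simp [hy]
  rw [← e]
  refine Lp.induction hq'.ne (motive := fun h =>
    Λ h = (ContinuousLinearMap.mul ℂ ℂ).lpPairing ν p q (hbp.toLp b) h) ?_ ?_ ?_ h
  · intro c s hs hμs
    have : ((Lp.simpleFunc.indicatorConst q hs hμs.ne c : Lp.simpleFunc ℂ q ν) : Lp ℂ q ν) =
        c • indicatorConstLp q hs hμs.ne (1 : ℂ) := by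
      rw [Lp.simpleFunc.coe_indicatorConst, indicatorConstLp, indicatorConstLp,
        ← MemLp.toLp_const_smul]
      congr 1
      ext y
      by_cases hy : y ∈ s <;> simp [hy]
    rw [this, map_smul, map_smul, hbΛ s hs, e, ← integral_indicator hs]
    congr 1
    refine integral_congr_ae ?_
    filter_upwards [indicatorConstLp_coeFn (p := q) (hs := hs) (hμs := hμs.ne) (c := (1 : ℂ))]
      with y hy
    rw [hy]
    by_cases hy : y ∈ s <;> simp [hy]
  · intro f g hf hg _ h1 h2
    rw [map_add, map_add, h1, h2]
  · exact isClosed_eq Λ.continuous (ContinuousLinearMap.continuous _)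

/-! ### Balls, normalized measures and atoms -/

variable {M : Type*}

/-- The balls of centre `x₀` and radius `1, 2, 3, …` absorb every ball. -/
theorem IsQuasiMetric.exists_cball_subset {ρ : M → M → ℝ} (h : IsQuasiMetric ρ) (x₀ x : M)
    (r : ℝ) : ∃ n : ℕ, cball ρ x r ⊆ cball ρ x₀ (n + 1) := by
  obtain ⟨K, hK⟩ := h.triangle
  obtain ⟨n, hn⟩ := exists_nat_ge (|K| * (ρ x₀ x + r))
  refine ⟨n, fun y hy => ?_⟩
  have hy' : ρ x y ≤ r := hy
  have h0 := h.nonneg x₀ x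
  have h1 := h.nonneg x y
  have h2 : K * (ρ x₀ x + ρ x y) ≤ |K| * (ρ x₀ x + r) :=
    mul_le_mul (le_abs_self K) (by linarith) (by linarith) (abs_nonneg K)
  have := hK x₀ x y
  change ρ x₀ y ≤ n + 1
  linarith

theorem cball_mono {ρ : M → M → ℝ} {x : M} {r s : ℝ} (h : r ≤ s) : cball ρ x r ⊆ cball ρ x s :=
  fun _ hy => le_trans hy h

variable [MeasurableSpace M] {ρ : M → M → ℝ} {μ : Measure M} {q : ℝ≥0∞}

theorem IsHomogeneousType.isProbabilityMeasure_cond (hM : IsHomogeneousType ρ μ) {x : M} {r : ℝ}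
    (hr : 0 < r) : IsProbabilityMeasure (cond μ (cball ρ x r)) :=
  cond_isProbabilityMeasure_of_finite (hM.measure_pos x r hr).ne' (hM.measure_lt_top x r hr).ne

theorem ae_cond_iff {B : Set M} (hB : MeasurableSet B) (hB' : μ B ≠ ∞) {P : M → Prop} :
    (∀ᵐ y ∂cond μ B, P y) ↔ ∀ᵐ y ∂μ, y ∈ B → P y := by
  rw [ProbabilityTheory.cond, Measure.ae_ennreal_smul_measure_iff (ENNReal.inv_ne_zero.2 hB'),
    ae_restrict_iff' hB]

theorem integral_cond (B : Set M) (f : M → ℂ) :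
    ∫ y, f y ∂cond μ B = ((μ B).toReal : ℂ)⁻¹ * ∫ y in B, f y ∂μ := by
  rw [ProbabilityTheory.cond, integral_smul_measure, ENNReal.toReal_inv, Complex.real_smul,
    Complex.ofReal_inv]

theorem memLp_cond_iff {B : Set M} (hB : μ B ≠ 0) (hB' : μ B ≠ ∞) {p : ℝ≥0∞} {f : M → ℂ} :
    MemLp f p (cond μ B) ↔ MemLp f p (μ.restrict B) := by
  constructor
  · intro h
    have := h.smul_measure (c := μ B) hB'
    rwa [ProbabilityTheory.cond, smul_smul, ENNReal.mul_inv_cancel hB hB', one_smul] at this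
  · intro h
    exact h.smul_measure (ENNReal.inv_ne_top.2 hB)

theorem indicator_ae_eq_of_ae_zero {B : Set M} {f : M → ℂ} (h : ∀ᵐ y ∂μ, y ∉ B → f y = 0) :
    B.indicator f =ᵐ[μ] f := by
  filter_upwards [h] with y hy
  by_cases hyB : y ∈ B
  · simp [hyB]
  · simp [hyB, hy hyB]

theorem memLp_one_of_ae_zero {B : Set M} (hB : MeasurableSet B) (hB' : μ B ≠ ∞) (hq : 1 ≤ q)
    {f : M → ℂ} (hf : MemLp f q μ) (h : ∀ᵐ y ∂μ, y ∉ B → f y = 0) : MemLp f 1 μ := by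
  have : IsFiniteMeasure (μ.restrict B) := ⟨by simpa using hB'.lt_top⟩
  refine MemLp.ae_eq (indicator_ae_eq_of_ae_zero h) ?_
  rw [memLp_indicator_iff_restrict hB]
  exact (hf.restrict B).mono_exponent hq

/-- A mean-zero `L^q` function supported in a ball is a multiple of an atom, with a factor
controlled by its `L^q` norm for the normalized measure on the ball. -/
theorem exists_atom_smul [Nonempty M] (hM : IsHomogeneousType ρ μ) {x : M} {r : ℝ} (hr : 0 < r)
    {k : Lp ℂ 1 μ} (hk : MemLp k q μ) (h0 : ∀ᵐ y ∂μ, y ∉ cball ρ x r → k y = 0)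
    (hint : ∫ y, k y ∂μ = 0) (hq : 1 ≤ q) :
    ∃ (a : Lp ℂ 1 μ) (c : ℂ), IsAtom ρ μ q a ∧ k = c • a ∧
      ‖c‖ₑ ≤ μ (cball ρ x r) * eLpNorm k q (cond μ (cball ρ x r)) := by
  set B := cball ρ x r
  have hB : MeasurableSet B := hM.measurableSet_cball x r hr
  have hB0 : μ B ≠ 0 := (hM.measure_pos x r hr).ne'
  have hBt : μ B ≠ ∞ := (hM.measure_lt_top x r hr).ne
  set N := eLpNorm k q (cond μ B) with hN
  have hNt : N ≠ ∞ := ((memLp_cond_iff hB0 hBt).2 (hk.restrict B)).2.ne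
  rcases eq_or_ne N 0 with hN0 | hN0
  · refine ⟨0, 0, isAtom_zero ρ μ q, ?_, by simp⟩
    rw [hN, eLpNorm_eq_zero_iff ((memLp_cond_iff hB0 hBt).2 (hk.restrict B)).1
      (zero_lt_one.trans_le hq).ne'] at hN0
    have := (ae_cond_iff hB hBt).1 hN0
    rw [smul_zero, Lp.eq_zero_iff_ae_eq_zero]
    filter_upwards [this, h0] with y h1 h2
    by_cases hy : y ∈ B
    · exact h1 hy
    · exact h2 hy
  · set c : ℝ := (μ B * N).toReal with hc
    have hct : μ B * N ≠ ∞ := ENNReal.mul_ne_top hBt hNt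
    have hc0 : 0 < c := ENNReal.toReal_pos (mul_ne_zero hB0 hN0) hct
    have hce : ‖(c : ℂ)‖ₑ = μ B * N := by
      rw [← ofReal_norm, Complex.norm_real, Real.norm_of_nonneg hc0.le, hc,
        ENNReal.ofReal_toReal hct]
    have hcc : (c : ℂ) ≠ 0 := by exact_mod_cast hc0.ne'
    have hae := Lp.coeFn_smul (c : ℂ)⁻¹ k
    refine ⟨(c : ℂ)⁻¹ • k, c, ⟨?_, x, r, hr, ?_, ?_, ?_⟩, ?_, hce.le⟩
    · exact (memLp_congr_ae hae).2 (hk.const_smul _)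
    · filter_upwards [hae, h0] with y h1 h2 hy
      rw [h1, Pi.smul_apply, h2 hy, smul_zero]
    · rw [integral_congr_ae hae]
      simp only [Pi.smul_apply]
      rw [integral_smul, hint, smul_zero]
    · have h' : ⇑((c : ℂ)⁻¹ • k) =ᵐ[cond μ B] (c : ℂ)⁻¹ • ⇑k := by
        refine (ae_cond_iff hB hBt).2 ?_
        filter_upwards [hae] with y hy _ using hy
      change eLpNorm _ q (cond μ B) ≤ _
      rw [eLpNorm_congr_ae h', eLpNorm_const_smul, enorm_inv hcc, hce,
        ENNReal.mul_inv (.inl hB0) (.inl hBt), mul_assoc, ENNReal.inv_mul_cancel hN0 hNt, mul_one]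
    · rw [smul_smul, mul_inv_cancel₀ hcc, one_smul]

theorem mem_Hfin_of_support_cball [Nonempty M] (hM : IsHomogeneousType ρ μ) {x : M} {r : ℝ}
    (hr : 0 < r) {k : Lp ℂ 1 μ} (hk : MemLp k q μ)
    (h0 : ∀ᵐ y ∂μ, y ∉ cball ρ x r → k y = 0) (hint : ∫ y, k y ∂μ = 0) (hq : 1 ≤ q) :
    k ∈ Hfin ρ μ q := by
  obtain ⟨a, c, ha, rfl, _⟩ := exists_atom_smul hM hr hk h0 hint hq
  exact Submodule.smul_mem _ _ (Submodule.subset_span ha)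

theorem enorm_apply_le_of_support_cball [Nonempty M] (hM : IsHomogeneousType ρ μ) (hq : 1 ≤ q)
    (ℓ : Hfin ρ μ q →ₗ[ℂ] ℂ) {A : ℝ≥0∞}
    (hℓ : ∀ a : Hfin ρ μ q, IsAtom ρ μ q a → ‖ℓ a‖ₑ ≤ A) {x : M} {r : ℝ}
    (hr : 0 < r) {k : Hfin ρ μ q} (hk : MemLp (k : Lp ℂ 1 μ) q μ)
    (h0 : ∀ᵐ y ∂μ, y ∉ cball ρ x r → (k : Lp ℂ 1 μ) y = 0)
    (hint : ∫ y, (k : Lp ℂ 1 μ) y ∂μ = 0) :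
    ‖ℓ k‖ₑ ≤ A * (μ (cball ρ x r) * eLpNorm (k : Lp ℂ 1 μ) q (cond μ (cball ρ x r))) := by
  obtain ⟨a, c, ha, hka, hc⟩ := exists_atom_smul hM hr hk h0 hint hq
  have : k = c • (⟨a, Submodule.subset_span ha⟩ : Hfin ρ μ q) := Subtype.ext hka
  rw [this, map_smul, smul_eq_mul, enorm_mul, mul_comm, ← this]
  exact mul_le_mul' (hℓ _ ha) hc

/-- Elements of `Hfin` are `L^q` functions of integral zero that are supported in some ball of an
exhausting sequence. -/
theorem memLp_and_support_of_mem_Hfin (hM : IsHomogeneousType ρ μ) (x₀ : M)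
    {g : Lp ℂ 1 μ} (hg : g ∈ Hfin ρ μ q) :
    MemLp g q μ ∧ ∫ y, g y ∂μ = 0 ∧
      ∃ n : ℕ, ∀ᵐ y ∂μ, y ∉ cball ρ x₀ (n + 1) → g y = 0 := by
  induction hg using Submodule.span_induction with
  | mem a ha =>
    obtain ⟨hq, x, r, _, h0, hi, _⟩ := ha
    obtain ⟨n, hn⟩ := hM.quasiMetric.exists_cball_subset x₀ x r
    refine ⟨hq, hi, n, ?_⟩
    filter_upwards [h0] with y hy h using hy fun h' => h (hn h')
  | zero =>
    have h := Lp.coeFn_zero ℂ 1 μ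
    refine ⟨(MemLp.zero (ε := ℂ)).ae_eq h.symm, by rw [integral_congr_ae h]; simp, 0, ?_⟩
    filter_upwards [h] with y hy _ using hy
  | add f g _ _ hf hg =>
    obtain ⟨h1, h2, n, h3⟩ := hf
    obtain ⟨h1', h2', n', h3'⟩ := hg
    have h := Lp.coeFn_add f g
    refine ⟨(h1.add h1').ae_eq h.symm, ?_, max n n', ?_⟩
    · rw [integral_congr_ae h]
      simp only [Pi.add_apply]
      rw [integral_add (L1.integrable_coeFn f) (L1.integrable_coeFn g), h2, h2', add_zero]
    · filter_upwards [h, h3, h3'] with y hy hy1 hy2 hn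
      rw [hy, Pi.add_apply, hy1, hy2, add_zero]
      · refine fun h' => hn (le_trans (show ρ x₀ y ≤ n' + 1 from h') ?_)
        gcongr; exact le_max_right _ _
      · refine fun h' => hn (le_trans (show ρ x₀ y ≤ n + 1 from h') ?_)
        gcongr; exact le_max_left _ _
  | smul c f _ hf =>
    obtain ⟨h1, h2, n, h3⟩ := hf
    have h := Lp.coeFn_smul c f
    refine ⟨(h1.const_smul c).ae_eq h.symm, ?_, n, ?_⟩
    · rw [integral_congr_ae h]
      simp only [Pi.smul_apply]
      rw [integral_smul, h2, smul_zero]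
    · filter_upwards [h, h3] with y hy hy1 hn
      rw [hy, Pi.smul_apply, hy1 hn, smul_zero]

/-! ### Representing functionals that are bounded on atoms -/

/-- The restriction of `h` to `B`, made into a function of integral zero by subtracting a multiple
of `ψ` (where `∫ ψ = 1`). -/
noncomputable def corrected (μ : Measure M) (ψ : M → ℂ) (B : Set M) (h : M → ℂ) : M → ℂ :=
  fun y => B.indicator h y - (∫ z in B, h z ∂μ) * ψ y

theorem corrected_congr {ψ : M → ℂ} {B : Set M} (hB : MeasurableSet B) {h h' : M → ℂ}
    (hh : h =ᵐ[μ.restrict B] h') : corrected μ ψ B h =ᵐ[μ] corrected μ ψ B h' := by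
  filter_upwards [(ae_restrict_iff' hB).1 hh] with y hy
  rw [corrected, corrected, integral_congr_ae hh]
  by_cases hyB : y ∈ B
  · simp [hyB, hy hyB]
  · simp [hyB]

theorem support_and_integral_of_ae_eq_corrected (hM : IsHomogeneousType ρ μ) (hq : 1 ≤ q)
    {x : M} {r : ℝ} (hr : 0 < r) {ψ : M → ℂ} (hψ : MemLp ψ q μ)
    (hψ0 : ∀ y, y ∉ cball ρ x r → ψ y = 0) (hψ1 : ∫ y, ψ y ∂μ = 1)
    {h : M → ℂ} (hh : MemLp h q (μ.restrict (cball ρ x r))) {g : M → ℂ}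
    (hg : g =ᵐ[μ] corrected μ ψ (cball ρ x r) h) :
    MemLp g q μ ∧ (∀ᵐ y ∂μ, y ∉ cball ρ x r → g y = 0) ∧ ∫ y, g y ∂μ = 0 := by
  set B := cball ρ x r
  have hB : MeasurableSet B := hM.measurableSet_cball x r hr
  have hBt : μ B ≠ ∞ := (hM.measure_lt_top x r hr).ne
  have hind : MemLp (B.indicator h) q μ := (memLp_indicator_iff_restrict hB).2 hh
  refine ⟨(hind.sub (hψ.const_mul _)).ae_eq hg.symm, ?_, ?_⟩
  · filter_upwards [hg] with y hy hyB
    simp [hy, corrected, hyB, hψ0 y hyB]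
  · rw [integral_congr_ae hg]
    have i1 : Integrable (B.indicator h) μ := memLp_one_iff_integrable.1
      (memLp_one_of_ae_zero hB hBt hq hind (.of_forall fun y hy => by simp [hy]))
    have i2 : Integrable ψ μ := memLp_one_iff_integrable.1
      (memLp_one_of_ae_zero hB hBt hq hψ (.of_forall hψ0))
    simp only [corrected]
    rw [integral_sub i1 (i2.const_mul _), integral_const_mul, hψ1, integral_indicator hB, mul_one,
      sub_self]

theorem exists_coeFn_ae_eq_corrected [Nonempty M] (hM : IsHomogeneousType ρ μ) (hq : 1 ≤ q)
    {x : M} {r : ℝ} (hr : 0 < r) {ψ : M → ℂ} (hψ : MemLp ψ q μ)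
    (hψ0 : ∀ y, y ∉ cball ρ x r → ψ y = 0) (hψ1 : ∫ y, ψ y ∂μ = 1)
    {h : M → ℂ} (hh : MemLp h q (μ.restrict (cball ρ x r))) :
    ∃ g : Hfin ρ μ q, (g : Lp ℂ 1 μ) =ᵐ[μ] corrected μ ψ (cball ρ x r) h := by
  obtain ⟨h1, h2, h3⟩ := support_and_integral_of_ae_eq_corrected hM hq hr hψ hψ0 hψ1 hh .rfl
  have hk1 : MemLp (corrected μ ψ (cball ρ x r) h) 1 μ := memLp_one_of_ae_zero
    (hM.measurableSet_cball x r hr) (hM.measure_lt_top x r hr).ne hq h1 h2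
  have hae := hk1.coeFn_toLp
  obtain ⟨h1, h2, h3⟩ := support_and_integral_of_ae_eq_corrected hM hq hr hψ hψ0 hψ1 hh hae
  exact ⟨⟨hk1.toLp _, mem_Hfin_of_support_cball hM hr h1 h2 h3 hq⟩, hae⟩

/-- The constant depends on the ball. It only has to be finite, to make the functionals on the balls
continuous; the bounds on the oscillation come from `eLpNorm_sub_average_le`. -/
theorem exists_eLpNorm_corrected_le (hM : IsHomogeneousType ρ μ) (hq : 1 ≤ q)
    {x : M} {r : ℝ} (hr : 0 < r) {ψ : M → ℂ} (hψ : MemLp ψ q μ) :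
    ∃ C : ℝ≥0∞, C ≠ ∞ ∧ ∀ h : M → ℂ, MemLp h q (μ.restrict (cball ρ x r)) →
      eLpNorm (corrected μ ψ (cball ρ x r) h) q (cond μ (cball ρ x r)) ≤
        C * eLpNorm h q (μ.restrict (cball ρ x r)) := by
  set B := cball ρ x r
  have hB : MeasurableSet B := hM.measurableSet_cball x r hr
  have hB0 : μ B ≠ 0 := (hM.measure_pos x r hr).ne'
  have hBt : μ B ≠ ∞ := (hM.measure_lt_top x r hr).ne
  have : IsFiniteMeasure (μ.restrict B) := ⟨by simpa using hBt.lt_top⟩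
  set α : ℝ≥0∞ := ((μ B)⁻¹) ^ (1 / q).toReal with hα
  have hαt : α ≠ ∞ :=
    ENNReal.rpow_ne_top_of_nonneg ENNReal.toReal_nonneg (ENNReal.inv_ne_top.2 hB0)
  set β : ℝ≥0∞ := (μ.restrict B) Set.univ ^ (1 / (1 : ℝ≥0∞).toReal - 1 / q.toReal) with hβ
  have hβt : β ≠ ∞ := by
    refine ENNReal.rpow_ne_top_of_nonneg ?_ (measure_ne_top _ _)
    rcases eq_or_ne q ∞ with rfl | hqt
    · simp
    have : 1 ≤ q.toReal := by
      rw [← ENNReal.toReal_one]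
      exact ENNReal.toReal_mono hqt hq
    have : 1 / q.toReal ≤ 1 := by rw [div_le_one (by linarith)]; exact this
    simpa using this
  set γ := eLpNorm ψ q (μ.restrict B) with hγ
  have hγt : γ ≠ ∞ := (hψ.restrict B).2.ne
  refine ⟨α * (1 + β * γ), by finiteness, fun h hh => ?_⟩
  rw [ProbabilityTheory.cond, eLpNorm_smul_measure_of_ne_zero (ENNReal.inv_ne_zero.2 hBt), ← hα,
    smul_eq_mul, mul_assoc]
  gcongr
  have e : corrected μ ψ B h =ᵐ[μ.restrict B] h - (∫ z in B, h z ∂μ) • ψ := by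
    filter_upwards [ae_restrict_mem hB] with y hy
    simp [corrected, hy]
  rw [eLpNorm_congr_ae e]
  refine (eLpNorm_sub_le hh.1 ((hψ.restrict B).1.const_smul _) hq).trans ?_
  rw [eLpNorm_const_smul, ← hγ, add_mul, one_mul]
  refine add_le_add_right ?_ _
  have h1 : ‖∫ z in B, h z ∂μ‖ₑ ≤ eLpNorm h 1 (μ.restrict B) := by
    rw [eLpNorm_one_eq_lintegral_enorm]
    exact enorm_integral_le_lintegral_enorm _
  have h2 := eLpNorm_le_eLpNorm_mul_rpow_measure_univ hq hh.1
  calc ‖∫ z in B, h z ∂μ‖ₑ * γ ≤ (eLpNorm h q (μ.restrict B) * β) * γ := by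
        gcongr; exact h1.trans h2
    _ = β * γ * eLpNorm h q (μ.restrict B) := by ring


theorem corrected_add {ψ : M → ℂ} {B : Set M} {h h' : M → ℂ}
    (hh : Integrable h (μ.restrict B)) (hh' : Integrable h' (μ.restrict B)) :
    corrected μ ψ B (h + h') = corrected μ ψ B h + corrected μ ψ B h' := by
  ext y
  simp only [corrected, Pi.add_apply]
  rw [integral_add hh hh', Set.indicator_add']
  simp only [Pi.add_apply]
  ring

theorem corrected_smul {ψ : M → ℂ} {B : Set M} (c : ℂ) (h : M → ℂ) :
    corrected μ ψ B (c • h) = c • corrected μ ψ B h := by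
  ext y
  simp only [corrected, Pi.smul_apply]
  rw [integral_smul]
  by_cases hy : y ∈ B <;> simp [hy] <;> ring

/-- Local representation: on `L^q` of a ball, the functional `h ↦ ℓ (h - (∫ h) ψ)` is given by a
function in `L^p` of the ball. Functions are matched to elements of `Hfin` up to null sets. -/
theorem exists_apply_eq_setIntegral_mul [Nonempty M] (hM : IsHomogeneousType ρ μ) {p : ℝ≥0∞}
    [ENNReal.HolderConjugate p q] (hq : 1 < q) (hq' : q < ∞)
    (ℓ : Hfin ρ μ q →ₗ[ℂ] ℂ) {A : ℝ≥0∞} (hA : A ≠ ∞)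
    (hℓ : ∀ a : Hfin ρ μ q, IsAtom ρ μ q a → ‖ℓ a‖ₑ ≤ A)
    {x : M} {r : ℝ} (hr : 0 < r) {ψ : M → ℂ} (hψ : MemLp ψ q μ)
    (hψ0 : ∀ y, y ∉ cball ρ x r → ψ y = 0) (hψ1 : ∫ y, ψ y ∂μ = 1) :
    ∃ b : M → ℂ, MemLp b p (μ.restrict (cball ρ x r)) ∧
      ∀ h : M → ℂ, MemLp h q (μ.restrict (cball ρ x r)) → ∀ g : Hfin ρ μ q,
        (g : Lp ℂ 1 μ) =ᵐ[μ] corrected μ ψ (cball ρ x r) h →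
          ℓ g = ∫ y in cball ρ x r, b y * h y ∂μ := by
  set B := cball ρ x r with hBdef
  have hB : MeasurableSet B := hM.measurableSet_cball x r hr
  have hB0 : μ B ≠ 0 := (hM.measure_pos x r hr).ne'
  have hBt : μ B ≠ ∞ := (hM.measure_lt_top x r hr).ne
  have : IsFiniteMeasure (μ.restrict B) := ⟨by simpa using hBt.lt_top⟩
  have : Fact (1 ≤ q) := ⟨hq.le⟩
  have hex : ∀ h : Lp ℂ q (μ.restrict B), ∃ g : Hfin ρ μ q,
      (g : Lp ℂ 1 μ) =ᵐ[μ] corrected μ ψ B h := fun h =>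
    exists_coeFn_ae_eq_corrected hM hq.le hr hψ hψ0 hψ1 (Lp.memLp h)
  choose J hJ using hex
  have hint : ∀ h : Lp ℂ q (μ.restrict B), Integrable h (μ.restrict B) := fun h =>
    (Lp.memLp h).integrable hq.le
  let L : Lp ℂ q (μ.restrict B) →ₗ[ℂ] Hfin ρ μ q :=
    { toFun := J
      map_add' := fun f g => by
        refine Subtype.ext (Lp.ext ?_)
        refine (hJ _).trans ?_
        refine (corrected_congr hB (Lp.coeFn_add f g)).trans ?_
        rw [corrected_add (hint f) (hint g)]
        exact ((hJ f).symm.add (hJ g).symm).trans (Lp.coeFn_add _ _).symm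
      map_smul' := fun c f => by
        refine Subtype.ext (Lp.ext ?_)
        refine (hJ _).trans ?_
        refine (corrected_congr hB (Lp.coeFn_smul c f)).trans ?_
        rw [corrected_smul]
        exact ((hJ f).symm.const_smul c).trans (Lp.coeFn_smul _ _).symm }
  obtain ⟨C, hC, hCb⟩ := exists_eLpNorm_corrected_le hM hq.le hr hψ (x := x)
  have hbd : ∀ h : Lp ℂ q (μ.restrict B), ‖(ℓ ∘ₗ L) h‖ ≤ (A * (μ B * C)).toReal * ‖h‖ := fun h => by
    obtain ⟨h1, h2, h3⟩ := support_and_integral_of_ae_eq_corrected hM hq.le hr hψ hψ0 hψ1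
      (Lp.memLp h) (hJ h)
    have h4 := enorm_apply_le_of_support_cball hM hq.le ℓ hℓ hr h1 h2 h3
    have h5 : eLpNorm (J h : Lp ℂ 1 μ) q (cond μ B) ≤ C * eLpNorm h q (μ.restrict B) := by
      rw [eLpNorm_congr_ae (g := corrected μ ψ B h)
        ((ae_cond_iff hB hBt).2 ((hJ h).mono fun y hy _ => hy))]
      exact hCb h (Lp.memLp h)
    have h6 : ‖ℓ (J h)‖ₑ ≤ (A * (μ B * C)) * ‖h‖ₑ := by
      rw [Lp.enorm_def]
      refine h4.trans ?_
      calc _ ≤ A * (μ B * (C * eLpNorm h q (μ.restrict B))) := by gcongr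
        _ = _ := by ring
    have := ENNReal.toReal_mono (by finiteness) h6
    rwa [ENNReal.toReal_mul, toReal_enorm, toReal_enorm] at this
  obtain ⟨b, hb, hbe⟩ := exists_forall_apply_eq_integral_mul (p := p) hq hq'
    ((ℓ ∘ₗ L).mkContinuous _ hbd)
  refine ⟨b, hb, fun h hh g hg => ?_⟩
  have e : g = J (hh.toLp h) := by
    refine Subtype.ext (Lp.ext ?_)
    exact hg.trans ((corrected_congr hB hh.coeFn_toLp.symm).trans (hJ _).symm)
  rw [e]
  refine (hbe (hh.toLp h)).trans (integral_congr_ae ?_)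
  filter_upwards [hh.coeFn_toLp] with y hy
  rw [hy]

/-- A functional on `Hfin` that is bounded on atoms is integration against a function that is in
`L^p` on all balls. The local representatives are glued: they agree because the same `ψ`, supported
in the smallest ball of the exhausting sequence, is used to normalize all of them. -/
theorem exists_apply_eq_integral_mul [Nonempty M] (hM : IsHomogeneousType ρ μ) {p : ℝ≥0∞}
    [hpq : ENNReal.HolderConjugate p q] (hq : 1 < q) (hq' : q < ∞)
    (ℓ : Hfin ρ μ q →ₗ[ℂ] ℂ) {A : ℝ≥0∞} (hA : A ≠ ∞)
    (hℓ : ∀ a : Hfin ρ μ q, IsAtom ρ μ q a → ‖ℓ a‖ₑ ≤ A) :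
    ∃ b : M → ℂ, AEStronglyMeasurable b μ ∧ (∀ x r, MemLp b p (μ.restrict (cball ρ x r))) ∧
      ∀ g : Hfin ρ μ q, ℓ g = ∫ y, b y * (g : Lp ℂ 1 μ) y ∂μ := by
  obtain ⟨x₀⟩ := ‹Nonempty M›
  have : Nonempty M := ⟨x₀⟩
  have hp : 1 ≤ p := ENNReal.HolderConjugate.one_le p q
  set B : ℕ → Set M := fun n => cball ρ x₀ (n + 1) with hBdef
  have hpos : ∀ n : ℕ, (0 : ℝ) < n + 1 := fun n => by positivity
  have hB : ∀ n, MeasurableSet (B n) := fun n => hM.measurableSet_cball x₀ _ (hpos n)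
  have hB0 : ∀ n, μ (B n) ≠ 0 := fun n => (hM.measure_pos x₀ _ (hpos n)).ne'
  have hBt : ∀ n, μ (B n) ≠ ∞ := fun n => (hM.measure_lt_top x₀ _ (hpos n)).ne
  have hfin : ∀ n, IsFiniteMeasure (μ.restrict (B n)) := fun n =>
    ⟨by simpa using (hBt n).lt_top⟩
  have hmono : ∀ {m n : ℕ}, m ≤ n → B m ⊆ B n := fun {m n} h => cball_mono (by gcongr)
  set ψ : M → ℂ := (B 0).indicator fun _ => ((μ (B 0)).toReal : ℂ)⁻¹ with hψdef
  have hψ : MemLp ψ q μ := memLp_indicator_const q (hB 0) _ (.inr (hBt 0))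
  have hψ0 : ∀ n y, y ∉ B n → ψ y = 0 := fun n y hy => by
    have : y ∉ B 0 := fun h => hy (hmono (Nat.zero_le n) h)
    simp [hψdef, this]
  have hψ1 : ∫ y, ψ y ∂μ = 1 := by
    have : ((μ (B 0)).toReal : ℂ) ≠ 0 := by
      exact_mod_cast (ENNReal.toReal_pos (hB0 0) (hBt 0)).ne'
    rw [hψdef, integral_indicator_const _ (hB 0), Measure.real, Complex.real_smul,
      mul_inv_cancel₀ this]
  have hrep := fun n => exists_apply_eq_setIntegral_mul hM (p := p) hq hq' ℓ hA hℓ (x := x₀)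
    (hpos n) hψ (hψ0 n) hψ1
  choose b hb hbe using hrep
  -- the local representatives agree: test with indicators of sets
  have hcons : ∀ m n, m ≤ n → b m =ᵐ[μ.restrict (B m)] b n := fun m n hmn => by
    have hsub := hmono hmn
    have i1 : Integrable (b m) (μ.restrict (B m)) := (hb m).integrable hp
    have i2 : Integrable (b n) (μ.restrict (B m)) :=
      ((hb n).mono_measure (Measure.restrict_mono hsub le_rfl)).integrable hp
    refine i1.ae_eq_of_forall_setIntegral_eq _ _ i2 fun s hs _ => ?_
    set h : M → ℂ := (s ∩ B m).indicator 1 with hh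
    have hhq : ∀ k, MemLp h q (μ.restrict (B k)) := fun k =>
      memLp_indicator_const q (hs.inter (hB m)) 1 (.inr (measure_ne_top _ _))
    have hsB : ∀ k, m ≤ k → ∀ f : M → ℂ,
        ∫ y in B k, f y * h y ∂μ = ∫ y in s, f y ∂μ.restrict (B m) :=
      fun k hk f => by
        rw [Measure.restrict_restrict hs, ← integral_indicator (hs.inter (hB m)),
          ← integral_indicator (hB k)]
        refine integral_congr_ae (.of_forall fun y => ?_)
        by_cases hy : y ∈ s ∩ B m
        · have := hmono hk hy.2
          simp [hh, hy, this]
        · simp [hh, hy]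
    have hce : corrected μ ψ (B n) h = corrected μ ψ (B m) h := by
      have e1 : ∫ y in B n, h y ∂μ = ∫ y in B m, h y ∂μ := by
        simpa using (hsB n hmn 1).trans (hsB m le_rfl 1).symm
      ext y
      rw [corrected, corrected, e1]
      congr 1
      by_cases hy : y ∈ B m
      · have := hsub hy
        simp [hy, this]
      · simp [hh, hy, Set.indicator]
    obtain ⟨g, hg⟩ := exists_coeFn_ae_eq_corrected hM hq.le (hpos m) hψ (hψ0 m) hψ1 (hhq m)
    rw [← hsB m le_rfl, ← hsB n hmn, ← hbe m h (hhq m) g hg]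
    refine hbe n h (hhq n) g ?_
    change _ =ᵐ[μ] corrected μ ψ (B n) h
    rw [hce]
    exact hg
  have hcov : ∀ y, ∃ n, y ∈ B n := fun y => by
    obtain ⟨n, hn⟩ := exists_nat_ge (ρ x₀ y)
    exact ⟨n, show ρ x₀ y ≤ n + 1 by linarith⟩
  classical
  -- outside a null set, `β` agrees with each `b n` on all of `B n`
  set β : M → ℂ := fun y => b (Nat.find (hcov y)) y with hβ
  have hall : ∀ᵐ y ∂μ, ∀ m n, m ≤ n → y ∈ B m → b m y = b n y := by
    simp only [ae_all_iff]
    exact fun m n hmn => (ae_restrict_iff' (hB m)).1 (hcons m n hmn)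
  have hβb : ∀ n, b n =ᵐ[μ.restrict (B n)] β := fun n => by
    refine (ae_restrict_iff' (hB n)).2 ?_
    filter_upwards [hall] with y hy hyn
    exact (hy _ _ (Nat.find_min' (hcov y) hyn) (Nat.find_spec (hcov y))).symm
  refine ⟨β, ?_, fun x r => ?_, fun g => ?_⟩
  · have : AEStronglyMeasurable β (μ.restrict (⋃ n, B n)) :=
      aestronglyMeasurable_iUnion_iff.2 fun n => ((hb n).ae_eq (hβb n)).1
    rwa [Set.iUnion_eq_univ_iff.2 hcov, Measure.restrict_univ] at this
  · obtain ⟨n, hn⟩ := hM.quasiMetric.exists_cball_subset x₀ x r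
    exact ((hb n).ae_eq (hβb n)).mono_measure (Measure.restrict_mono hn le_rfl)
  · obtain ⟨h1, h2, n, h3⟩ := memLp_and_support_of_mem_Hfin hM x₀ g.2
    have h3' : (B n).indicator (g : Lp ℂ 1 μ) =ᵐ[μ] (g : Lp ℂ 1 μ) := indicator_ae_eq_of_ae_zero h3
    have hi : ∫ y in B n, (g : Lp ℂ 1 μ) y ∂μ = 0 := by
      rw [← integral_indicator (hB n), integral_congr_ae h3', h2]
    rw [hbe n (g : Lp ℂ 1 μ) (h1.restrict _) g ?_]
    · change ∫ y in B n, _ ∂μ = _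
      have : ∫ y in B n, b n y * (g : Lp ℂ 1 μ) y ∂μ = ∫ y in B n, β y * (g : Lp ℂ 1 μ) y ∂μ := by
        refine integral_congr_ae ?_
        filter_upwards [hβb n] with y hy
        rw [hy]
      rw [this, ← integral_indicator (hB n)]
      refine integral_congr_ae ?_
      filter_upwards [h3] with y hy
      by_cases hyB : y ∈ B n
      · simp [hyB]
      · simp [hyB, hy hyB]
    · change _ =ᵐ[μ] corrected μ ψ (B n) _
      filter_upwards [h3'] with y hy
      rw [corrected, hi, hy]
      simp

/-! ### Truncation -/

/-- Truncation of the real and the imaginary part of `z` to `[-N, N]`. -/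
noncomputable def truncate (N : ℝ) (z : ℂ) : ℂ := ⟨max (min z.re N) (-N), max (min z.im N) (-N)⟩

theorem norm_truncate_sub_le (N : ℝ) (z w : ℂ) : ‖truncate N z - truncate N w‖ ≤ ‖z - w‖ := by
  have h : ∀ s t : ℝ, |max (min s N) (-N) - max (min t N) (-N)| ≤ |s - t| := fun s t =>
    (abs_max_sub_max_le_abs _ _ _).trans (abs_inf_sub_inf_le_abs _ _ _)
  rw [Complex.norm_def, Complex.norm_def, Complex.normSq_apply, Complex.normSq_apply]
  refine Real.sqrt_le_sqrt ?_
  rw [← abs_mul_abs_self (truncate N z - truncate N w).re,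
    ← abs_mul_abs_self (truncate N z - truncate N w).im, ← abs_mul_abs_self (z - w).re,
    ← abs_mul_abs_self (z - w).im]
  have h1 : |(truncate N z - truncate N w).re| ≤ |(z - w).re| := h _ _
  have h2 : |(truncate N z - truncate N w).im| ≤ |(z - w).im| := h _ _
  gcongr

theorem continuous_truncate (N : ℝ) : Continuous (truncate N) :=
  (LipschitzWith.of_dist_le_mul (K := 1) fun z w => by
    simpa [dist_eq_norm] using norm_truncate_sub_le N z w).continuous

theorem norm_truncate_le_norm {N : ℝ} (hN : 0 ≤ N) (z : ℂ) : ‖truncate N z‖ ≤ ‖z‖ := by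
  have h0 : truncate N 0 = 0 := by
    apply Complex.ext <;> simp [truncate, hN]
  simpa [h0] using norm_truncate_sub_le N z 0

theorem norm_truncate_le {N : ℝ} (hN : 0 ≤ N) (z : ℂ) : ‖truncate N z‖ ≤ N + N := by
  have h : ∀ s : ℝ, |max (min s N) (-N)| ≤ N := fun s =>
    abs_le.2 ⟨le_max_right _ _, max_le (min_le_right _ _) (by linarith)⟩
  exact (Complex.norm_le_abs_re_add_abs_im _).trans (add_le_add (h _) (h _))

theorem truncate_of_norm_le {N : ℝ} {z : ℂ} (h : ‖z‖ ≤ N) : truncate N z = z := by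
  have h1 := abs_le.1 ((Complex.abs_re_le_norm z).trans h)
  have h2 := abs_le.1 ((Complex.abs_im_le_norm z).trans h)
  apply Complex.ext <;> simp [truncate, h1, h2]


/-! ### Bounded mean oscillation and the main estimate -/

/-- The representing function has bounded mean oscillation, in the `L^p` sense. The factor `2` comes
from subtracting the average from the test function to make it mean-zero. -/
theorem eLpNorm_sub_average_le [Nonempty M] (hM : IsHomogeneousType ρ μ) {p : ℝ≥0∞}
    [hpq : ENNReal.HolderConjugate p q] (hq : 1 < q) (hq' : q < ∞)
    (ℓ : Hfin ρ μ q →ₗ[ℂ] ℂ) {A : ℝ≥0∞}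
    (hℓ : ∀ a : Hfin ρ μ q, IsAtom ρ μ q a → ‖ℓ a‖ₑ ≤ A) {b : M → ℂ}
    (hb : ∀ x r, MemLp b p (μ.restrict (cball ρ x r)))
    (hrep : ∀ g : Hfin ρ μ q, ℓ g = ∫ y, b y * (g : Lp ℂ 1 μ) y ∂μ) {x : M} {r : ℝ} (hr : 0 < r) :
    eLpNorm (fun y => b y - ∫ z, b z ∂cond μ (cball ρ x r)) p (cond μ (cball ρ x r)) ≤ 2 * A := by
  set B := cball ρ x r with hBdef
  have hB : MeasurableSet B := hM.measurableSet_cball x r hr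
  have hB0 : μ B ≠ 0 := (hM.measure_pos x r hr).ne'
  have hBt : μ B ≠ ∞ := (hM.measure_lt_top x r hr).ne
  have : IsProbabilityMeasure (cond μ B) := hM.isProbabilityMeasure_cond hr
  have hp : 1 ≤ p := ENNReal.HolderConjugate.one_le p q
  have hbν : MemLp b p (cond μ B) := (memLp_cond_iff hB0 hBt).2 (hb x r)
  have hbi : Integrable b (cond μ B) := hbν.integrable hp
  set m := ∫ z, b z ∂cond μ B with hm
  refine eLpNorm_le_of_integral_mul_le hq hq' (hbν.1.sub aestronglyMeasurable_const) ?_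
  rintro φ hφ ⟨C, hC⟩
  have hφν : ∀ s, MemLp φ s (cond μ B) := fun s =>
    MemLp.of_bound hφ.aestronglyMeasurable C (.of_forall hC)
  set w := ∫ z, φ z ∂cond μ B with hw
  have hbφ : Integrable (fun y => b y * φ y) (cond μ B) :=
    hbi.mul_bdd hφ.aestronglyMeasurable (.of_forall hC)
  -- moving the average from `b` to the test function
  have e1 : ∫ y, (b y - m) * φ y ∂cond μ B = ∫ y, b y * (φ y - w) ∂cond μ B := by
    have i1 : Integrable φ (cond μ B) := (hφν 1).integrable le_rfl
    simp only [sub_mul, mul_sub]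
    rw [integral_sub hbφ (i1.const_mul _), integral_sub hbφ (hbi.mul_const _), integral_const_mul,
      integral_mul_const]
  set k : M → ℂ := B.indicator fun y => φ y - w with hk
  have hks : ∀ s, MemLp k s μ := fun s => (memLp_indicator_iff_restrict hB).2
    ((memLp_cond_iff hB0 hBt).1 ((hφν s).sub (memLp_const w)))
  have hae := (hks 1).coeFn_toLp
  have hkq : MemLp ((hks 1).toLp k) q μ := (hks q).ae_eq hae.symm
  have hk0 : ∀ᵐ y ∂μ, y ∉ B → (hks 1).toLp k y = 0 := by
    filter_upwards [hae] with y hy hyB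
    rw [hy, hk, Set.indicator_of_notMem hyB]
  have hki : ∫ y, (hks 1).toLp k y ∂μ = 0 := by
    rw [integral_congr_ae hae, hk, integral_indicator hB]
    have h1 : ∫ y, (φ y - w) ∂cond μ B = 0 := by
      rw [integral_sub ((hφν 1).integrable le_rfl) (integrable_const _)]
      simp [hw]
    rw [integral_cond, mul_eq_zero] at h1
    refine h1.resolve_left (inv_ne_zero ?_)
    exact_mod_cast (ENNReal.toReal_pos hB0 hBt).ne'
  set g : Hfin ρ μ q := ⟨(hks 1).toLp k, mem_Hfin_of_support_cball hM hr hkq hk0 hki hq.le⟩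
  have e2 : ∫ y, b y * (φ y - w) ∂cond μ B = ((μ B).toReal : ℂ)⁻¹ * ℓ g := by
    rw [integral_cond, hrep, ← integral_indicator hB]
    congr 1
    refine integral_congr_ae ?_
    filter_upwards [hae] with y hy
    change _ = b y * ((hks 1).toLp k) y
    rw [hy]
    by_cases hyB : y ∈ B <;> simp [hk, hyB]
  have hg := enorm_apply_le_of_support_cball hM hq.le ℓ hℓ (k := g) hr hkq hk0 hki
  have e3 : eLpNorm (g : Lp ℂ 1 μ) q (cond μ B) = eLpNorm (φ - fun _ => w) q (cond μ B) := by
    refine eLpNorm_congr_ae ((ae_cond_iff hB hBt).2 ?_)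
    filter_upwards [hae] with y hy hyB
    change ((hks 1).toLp k) y = _
    rw [hy]
    simp [hk, hyB]
  have e4 : eLpNorm (φ - fun _ => w) q (cond μ B) ≤ 2 * eLpNorm φ q (cond μ B) := by
    refine (eLpNorm_sub_le (hφν q).1 aestronglyMeasurable_const hq.le).trans ?_
    rw [two_mul]
    gcongr
    rw [eLpNorm_const _ (zero_lt_one.trans hq).ne' (IsProbabilityMeasure.ne_zero _)]
    simp only [measure_univ, ENNReal.one_rpow, mul_one]
    calc ‖w‖ₑ ≤ eLpNorm φ 1 (cond μ B) := by
          rw [eLpNorm_one_eq_lintegral_enorm]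
          exact enorm_integral_le_lintegral_enorm _
      _ ≤ _ := eLpNorm_le_eLpNorm_of_exponent_le hq.le (hφν q).1
  have e5 : ‖((μ B).toReal : ℂ)⁻¹‖ₑ = (μ B)⁻¹ := by
    rw [enorm_inv (by exact_mod_cast (ENNReal.toReal_pos hB0 hBt).ne'), ← ofReal_norm,
      Complex.norm_real, Real.norm_of_nonneg ENNReal.toReal_nonneg, ENNReal.ofReal_toReal hBt]
  change ‖∫ y, (b y - m) * φ y ∂cond μ B‖ₑ ≤ _
  rw [e1, e2, enorm_mul, e5]
  calc (μ B)⁻¹ * ‖ℓ g‖ₑ ≤ (μ B)⁻¹ * (A * (μ B * (2 * eLpNorm φ q (cond μ B)))) := by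
        gcongr
        refine hg.trans ?_
        rw [e3]
        gcongr
    _ = ((μ B)⁻¹ * μ B) * (2 * A * eLpNorm φ q (cond μ B)) := by ring
    _ = _ := by rw [ENNReal.inv_mul_cancel hB0 hBt, one_mul]

/-- A bounded function `β` which on each ball oscillates at most as much as `b` has integral at most
`D` against every atom: subtract a constant from `β` and apply Hölder's inequality. -/
theorem enorm_integral_mul_atom_le (hM : IsHomogeneousType ρ μ) {p : ℝ≥0∞}
    [hpq : ENNReal.HolderConjugate p q] {b β : M → ℂ} (hβ : AEStronglyMeasurable β μ) {C : ℝ}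
    (hC : ∀ y, ‖β y‖ ≤ C) {D : ℝ≥0∞}
    (hosc : ∀ x r, 0 < r → ∃ m m' : ℂ, (∀ y, ‖β y - m'‖ ≤ ‖b y - m‖) ∧
      eLpNorm (fun y => b y - m) p (cond μ (cball ρ x r)) ≤ D)
    {a : Lp ℂ 1 μ} (ha : IsAtom ρ μ q a) :
    ‖∫ y, β y * a y ∂μ‖ₑ ≤ D := by
  obtain ⟨haq, x, r, hr, h0, hi, hn⟩ := ha
  set B := cball ρ x r with hBdef
  have hB : MeasurableSet B := hM.measurableSet_cball x r hr
  have hB0 : μ B ≠ 0 := (hM.measure_pos x r hr).ne'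
  have hBt : μ B ≠ ∞ := (hM.measure_lt_top x r hr).ne
  obtain ⟨m, m', hmm, hD⟩ := hosc x r hr
  have hai : Integrable a μ := L1.integrable_coeFn a
  have e1 : ∫ y, β y * a y ∂μ = ∫ y in B, (β y - m') * a y ∂μ := by
    have : ∫ y, β y * a y ∂μ = ∫ y, (β y - m') * a y ∂μ := by
      simp only [sub_mul]
      rw [integral_sub (hai.bdd_mul hβ (.of_forall hC)) (hai.const_mul _), integral_const_mul, hi,
        mul_zero, sub_zero]
    rw [this, ← integral_indicator hB]
    refine integral_congr_ae ?_
    filter_upwards [h0] with y hy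
    by_cases hyB : y ∈ B
    · simp [hyB]
    · simp [hyB, hy hyB]
  have e2 : ∫⁻ y in B, ‖(β y - m') * a y‖ₑ ∂μ = μ B * ∫⁻ y, ‖(β y - m') * a y‖ₑ ∂cond μ B := by
    rw [ProbabilityTheory.cond, lintegral_smul_measure, smul_eq_mul, ← mul_assoc,
      ENNReal.mul_inv_cancel hB0 hBt, one_mul]
  have hν : cond μ B ≪ μ := cond_absolutelyContinuous
  have e3 : ∫⁻ y, ‖(β y - m') * a y‖ₑ ∂cond μ B ≤
      eLpNorm (fun y => β y - m') p (cond μ B) * eLpNorm a q (cond μ B) := by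
    have := eLpNorm_smul_le_mul_eLpNorm (p := p) (q := q) (r := 1) (μ := cond μ B)
      (haq.1.mono_ac hν) ((hβ.sub (aestronglyMeasurable_const (b := m'))).mono_ac hν)
    rwa [eLpNorm_one_eq_lintegral_enorm] at this
  rw [e1]
  refine (enorm_integral_le_lintegral_enorm _).trans ?_
  rw [e2]
  calc _ ≤ μ B * (D * (μ B)⁻¹) := by
        refine mul_le_mul_right (e3.trans (mul_le_mul' ?_ hn)) _
        exact (eLpNorm_mono hmm).trans hD
    _ = D * (μ B * (μ B)⁻¹) := by ring
    _ = D := by rw [ENNReal.mul_inv_cancel hB0 hBt, mul_one]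

/-- For bounded `β`, integration against `β` is continuous on `L^1` and may be applied term by term
to an atomic decomposition. -/
theorem norm_integral_mul_le_of_decomp {β : M → ℂ} (hβ : AEStronglyMeasurable β μ) {C : ℝ}
    (hC : ∀ y, ‖β y‖ ≤ C) {D : ℝ} (hD : ∀ a, IsAtom ρ μ q a → ‖∫ y, β y * a y ∂μ‖ ≤ D)
    {g : Lp ℂ 1 μ} {c : ℕ → ℂ} {a : ℕ → Lp ℂ 1 μ} (h : IsAtomicDecomp ρ μ q g c a) :
    ‖∫ y, β y * g y ∂μ‖ ≤ D * ∑' j, ‖c j‖ := by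
  have : ENNReal.HolderConjugate ∞ 1 := ENNReal.HolderConjugate.top_one
  have hβL : MemLp β ∞ μ := memLp_top_of_bound hβ C (.of_forall hC)
  set F := (ContinuousLinearMap.mul ℂ ℂ).lpPairing μ ∞ 1 (hβL.toLp β) with hF
  have e : ∀ f : Lp ℂ 1 μ, F f = ∫ y, β y * f y ∂μ := fun f => by
    rw [hF, ContinuousLinearMap.lpPairing_eq_integral]
    refine integral_congr_ae ?_
    filter_upwards [hβL.coeFn_toLp] with y hy
    simp [hy]
  have hs := h.hasSum.mapL F
  rw [← e]
  refine hs.norm_le_of_bounded (h.summable.hasSum.mul_left D) fun j => ?_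
  rw [map_smul, e, norm_smul, mul_comm]
  gcongr
  exact hD _ (h.atom j)

/-- The main estimate for functionals: the bound on atoms carries over to arbitrary atomic
decompositions of elements of `Hfin`. -/
theorem norm_apply_le_of_decomp [Nonempty M] (hM : IsHomogeneousType ρ μ)
    (hq : 1 < q) (hq' : q < ∞) (ℓ : Hfin ρ μ q →ₗ[ℂ] ℂ) {A : ℝ} (hA : 0 ≤ A)
    (hℓ : ∀ a : Hfin ρ μ q, IsAtom ρ μ q a → ‖ℓ a‖ ≤ A)
    {g : Hfin ρ μ q} {c : ℕ → ℂ} {a : ℕ → Lp ℂ 1 μ} (h : IsAtomicDecomp ρ μ q g c a) :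
    ‖ℓ g‖ ≤ 2 * A * ∑' j, ‖c j‖ := by
  set p := ENNReal.conjExponent q
  have hpq : ENNReal.HolderConjugate p q := (ENNReal.HolderConjugate.conjExponent hq.le).symm
  have hℓ' : ∀ a : Hfin ρ μ q, IsAtom ρ μ q a → ‖ℓ a‖ₑ ≤ ENNReal.ofReal A := fun a ha => by
    rw [← ofReal_norm]
    exact ENNReal.ofReal_le_ofReal (hℓ a ha)
  obtain ⟨b, hbm, hb, hrep⟩ := exists_apply_eq_integral_mul hM (p := p) hq hq' ℓ
    ENNReal.ofReal_ne_top hℓ'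
  have hN : ∀ N : ℕ, ‖∫ y, truncate N (b y) * (g : Lp ℂ 1 μ) y ∂μ‖ ≤ 2 * A *
      ∑' j, ‖c j‖ := fun N => by
    have hβ : AEStronglyMeasurable (fun y => truncate N (b y)) μ :=
      (continuous_truncate N).comp_aestronglyMeasurable hbm
    have hbd := fun y => norm_truncate_le N.cast_nonneg (b y)
    refine norm_integral_mul_le_of_decomp hβ hbd (fun a ha => ?_) h
    have := enorm_integral_mul_atom_le hM (p := p) (b := b) (D := 2 * ENNReal.ofReal A) hβ hbd
      (fun x r hr => ⟨_, _, fun y => norm_truncate_sub_le N (b y) _,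
        eLpNorm_sub_average_le hM hq hq' ℓ hℓ' hb hrep hr⟩) ha
    have := ENNReal.toReal_mono (by finiteness) this
    rwa [toReal_enorm, ENNReal.toReal_mul, ENNReal.toReal_ofReal hA] at this
  obtain ⟨x₀⟩ := ‹Nonempty M›
  obtain ⟨h1, -, n, h3⟩ := memLp_and_support_of_mem_Hfin hM x₀ g.2
  have hB : MeasurableSet (cball ρ x₀ (n + 1)) := hM.measurableSet_cball x₀ _ (by positivity)
  have hint : Integrable (fun y => b y * (g : Lp ℂ 1 μ) y) μ := by
    have h4 : Integrable (fun y => b y * (g : Lp ℂ 1 μ) y) (μ.restrict (cball ρ x₀ (n + 1))) :=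
      (hb x₀ (n + 1)).integrable_mul (h1.restrict _)
    refine ((integrable_indicator_iff hB).2 h4).congr (indicator_ae_eq_of_ae_zero ?_)
    filter_upwards [h3] with y hy hyB
    rw [hy hyB, mul_zero]
  rw [hrep]
  refine le_of_tendsto' (x := atTop) (Tendsto.norm ?_) hN
  refine tendsto_integral_of_dominated_convergence (fun y => ‖b y * (g : Lp ℂ 1 μ) y‖) (fun N => ?_)
    hint.norm (fun N => .of_forall fun y => ?_) (.of_forall fun y => ?_)
  · exact ((continuous_truncate N).comp_aestronglyMeasurable hbm).mul
      (L1.integrable_coeFn (g : Lp ℂ 1 μ)).1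
  · rw [norm_mul, norm_mul]
    gcongr
    exact norm_truncate_le_norm N.cast_nonneg _
  · obtain ⟨N₀, hN₀⟩ := exists_nat_ge ‖b y‖
    refine tendsto_const_nhds.congr' ?_
    filter_upwards [eventually_ge_atTop N₀] with N hN
    rw [truncate_of_norm_le (hN₀.trans (by exact_mod_cast hN))]

/-! ### Atomic decompositions and the extension -/


namespace IsAtomicDecomp

theorem single {a : Lp ℂ 1 μ} (ha : IsAtom ρ μ q a) :
    IsAtomicDecomp ρ μ q a (Pi.single 0 1) fun _ => a where
  atom _ := ha
  summable := summable_of_ne_finset_zero (s := {0}) fun j hj => by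
    simp [Pi.single_eq_of_ne (Finset.notMem_singleton.1 hj)]
  hasSum := by
    simpa using hasSum_single (f := fun j : ℕ => (Pi.single 0 1 : ℕ → ℂ) j • a) 0
      (fun j hj => by simp [Pi.single_eq_of_ne hj])

theorem tail {g : Lp ℂ 1 μ} {c : ℕ → ℂ} {a : ℕ → Lp ℂ 1 μ} (h : IsAtomicDecomp ρ μ q g c a)
    (n : ℕ) : IsAtomicDecomp ρ μ q (g - ∑ j ∈ Finset.range n, c j • a j) (fun j => c (j + n))
      fun j => a (j + n) where
  atom _ := h.atom _
  summable := (summable_nat_add_iff n).2 h.summable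
  hasSum := (hasSum_nat_add_iff' n).2 h.hasSum

theorem h1Norm_le {g : Lp ℂ 1 μ} {c : ℕ → ℂ} {a : ℕ → Lp ℂ 1 μ}
    (h : IsAtomicDecomp ρ μ q g c a) : h1Norm ρ μ q g ≤ ∑' j, ‖c j‖ := by
  refine csInf_le ⟨0, ?_⟩ ⟨c, a, h, rfl⟩
  rintro _ ⟨c', a', _, rfl⟩
  exact tsum_nonneg fun _ => norm_nonneg _

end IsAtomicDecomp

theorem h1Norm_nonneg (g : Lp ℂ 1 μ) : 0 ≤ h1Norm ρ μ q g := by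
  refine Real.sInf_nonneg ?_
  rintro _ ⟨c, a, _, rfl⟩
  exact tsum_nonneg fun _ => norm_nonneg _

theorem le_mul_h1Norm [Nonempty M] {g : Lp ℂ 1 μ} (hg : g ∈ H1 ρ μ q) {A t : ℝ} (hA : 0 ≤ A)
    (h : ∀ c a, IsAtomicDecomp ρ μ q g c a → t ≤ A * ∑' j, ‖c j‖) : t ≤ A * h1Norm ρ μ q g := by
  obtain ⟨c, a, hd⟩ := hg
  rcases hA.eq_or_lt with rfl | hA
  · simpa using h c a hd
  · rw [← div_le_iff₀' hA]
    refine le_csInf ⟨_, c, a, hd, rfl⟩ ?_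
    rintro _ ⟨c', a', hd', rfl⟩
    rw [div_le_iff₀' hA]
    exact h c' a' hd'

/-- A linear map that is bounded by `∑ |c j|` for all atomic decompositions may be applied term by
term: the remainder after `n` terms has the tail of the series as an atomic decomposition. -/
theorem hasSum_apply_atoms {E : Type*} [NormedAddCommGroup E] [NormedSpace ℂ E] [CompleteSpace E]
    {V : Submodule ℂ (Lp ℂ 1 μ)} (hV : ∀ a, IsAtom ρ μ q a → a ∈ V) (L : V →ₗ[ℂ] E) {C : ℝ}
    (hL : ∀ (g : V) c a, IsAtomicDecomp ρ μ q g c a → ‖L g‖ ≤ C * ∑' j, ‖c j‖)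
    {g : V} {c : ℕ → ℂ} {a : ℕ → Lp ℂ 1 μ} (h : IsAtomicDecomp ρ μ q g c a) :
    HasSum (fun j => c j • L ⟨a j, hV _ (h.atom j)⟩) (L g) := by
  have hatom : ∀ j, ‖L ⟨a j, hV _ (h.atom j)⟩‖ ≤ C := fun j => by
    have h1 := hL ⟨a j, hV _ (h.atom j)⟩ _ _ (IsAtomicDecomp.single (h.atom j))
    rwa [tsum_eq_single 0 fun j hj => by simp [Pi.single_eq_of_ne hj], Pi.single_eq_same, norm_one,
      mul_one] at h1
  have hs : Summable fun j => c j • L ⟨a j, hV _ (h.atom j)⟩ := by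
    refine Summable.of_norm_bounded (h.summable.mul_right C) fun j => ?_
    rw [norm_smul]
    gcongr
    exact hatom j
  refine (hs.hasSum_iff_tendsto_nat).2 ?_
  rw [tendsto_iff_norm_sub_tendsto_zero]
  have htail : Tendsto (fun n => C * ∑' j, ‖c (j + n)‖) atTop (𝓝 0) := by
    simpa using (tendsto_sum_nat_add fun j => ‖c j‖).const_mul C
  refine squeeze_zero (fun _ => norm_nonneg _) (fun n => ?_) htail
  have e : (∑ j ∈ Finset.range n, c j • L ⟨a j, hV _ (h.atom j)⟩) - L g =
      -L (g - ∑ j ∈ Finset.range n, c j • ⟨a j, hV _ (h.atom j)⟩) := by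
    rw [map_sub, map_sum]
    simp only [map_smul, neg_sub]
  rw [e, norm_neg]
  refine hL _ _ (fun j => a (j + n)) ?_
  simpa using h.tail n

/-- `t = ∑ j, c j • T (a j)` for some atomic decomposition `g = ∑ j, c j • a j`. This relation is
the graph of the extension of `T` to `H1`. -/
def IsSumOfImages (T : Hfin ρ μ q →ₗ[ℂ] Lp ℂ 1 μ) (g t : Lp ℂ 1 μ) : Prop :=
  ∃ (c : ℕ → ℂ) (a : ℕ → Lp ℂ 1 μ) (h : IsAtomicDecomp ρ μ q g c a),
    HasSum (fun j => c j • T ⟨a j, Submodule.subset_span (h.atom j)⟩) t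

namespace IsSumOfImages

variable {T : Hfin ρ μ q →ₗ[ℂ] Lp ℂ 1 μ} {g g' t t' : Lp ℂ 1 μ}

theorem add (h : IsSumOfImages T g t) (h' : IsSumOfImages T g' t') :
    IsSumOfImages T (g + g') (t + t') := by
  obtain ⟨c, a, hd, hs⟩ := h
  obtain ⟨c', a', hd', hs'⟩ := h'
  let e : ℕ ≃ ℕ ⊕ ℕ := Equiv.natSumNatEquivNat.symm
  have hatom : ∀ s, IsAtom ρ μ q (Sum.elim a a' s) := by
    rintro (i | i)
    · exact hd.atom i
    · exact hd'.atom i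
  refine ⟨Sum.elim c c' ∘ e, Sum.elim a a' ∘ e, ⟨fun j => hatom _, ?_, ?_⟩, ?_⟩
  · exact (e.summable_iff (f := fun s => ‖Sum.elim c c' s‖)).2
      (HasSum.sum (f := fun s => ‖Sum.elim c c' s‖) hd.summable.hasSum
        hd'.summable.hasSum).summable
  · exact (e.hasSum_iff (f := fun s => Sum.elim c c' s • Sum.elim a a' s)).2
      (HasSum.sum (f := fun s => Sum.elim c c' s • Sum.elim a a' s) hd.hasSum hd'.hasSum)
  · exact (e.hasSum_iff (f := fun s => Sum.elim c c' s •
      T ⟨Sum.elim a a' s, Submodule.subset_span (hatom s)⟩)).2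
      (HasSum.sum (f := fun s => Sum.elim c c' s •
        T ⟨Sum.elim a a' s, Submodule.subset_span (hatom s)⟩) hs hs')

theorem smul (h : IsSumOfImages T g t) (z : ℂ) : IsSumOfImages T (z • g) (z • t) := by
  obtain ⟨c, a, hd, hs⟩ := h
  refine ⟨fun j => z * c j, a, ⟨hd.atom, ?_, ?_⟩, ?_⟩
  · simpa using hd.summable.mul_left ‖z‖
  · simpa [mul_smul] using hd.hasSum.const_smul z
  · simpa [mul_smul] using hs.const_smul z

theorem eq_apply {C : ℝ} (hT : ∀ (g : Hfin ρ μ q) c a, IsAtomicDecomp ρ μ q g c a →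
      ‖T g‖ ≤ C * ∑' j, ‖c j‖) {f : Hfin ρ μ q} (h : IsSumOfImages T f t) : t = T f := by
  obtain ⟨c, a, hd, hs⟩ := h
  exact hs.unique (hasSum_apply_atoms (fun _ ha => Submodule.subset_span ha) T hT hd)

theorem unique {C : ℝ} (hT : ∀ (g : Hfin ρ μ q) c a, IsAtomicDecomp ρ μ q g c a →
      ‖T g‖ ≤ C * ∑' j, ‖c j‖) (h : IsSumOfImages T g t) (h' : IsSumOfImages T g t') : t = t' := by
  have h0 := h.add (h'.smul (-1))
  rw [neg_one_smul, neg_one_smul, add_neg_cancel] at h0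
  have := eq_apply hT (f := 0) h0
  rwa [map_zero, add_neg_eq_zero] at this

end IsSumOfImages

theorem summable_smul_apply_atoms {T : Hfin ρ μ q →ₗ[ℂ] Lp ℂ 1 μ} {A : ℝ}
    (hA : ∀ a : Hfin ρ μ q, IsAtom ρ μ q a → ‖T a‖ ≤ A) {g : Lp ℂ 1 μ} {c : ℕ → ℂ}
    {a : ℕ → Lp ℂ 1 μ} (h : IsAtomicDecomp ρ μ q g c a) :
    Summable fun j => c j • T ⟨a j, Submodule.subset_span (h.atom j)⟩ := by
  refine Summable.of_norm_bounded (h.summable.mul_right A) fun j => ?_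
  rw [norm_smul]
  gcongr
  exact hA _ (h.atom j)

/-- The extension of `T`, given by summing the images of the atoms of any decomposition. -/
theorem exists_extension [Nonempty M] {T : Hfin ρ μ q →ₗ[ℂ] Lp ℂ 1 μ} {C A : ℝ}
    (hT : ∀ (g : Hfin ρ μ q) c a, IsAtomicDecomp ρ μ q g c a → ‖T g‖ ≤ C * ∑' j, ‖c j‖)
    (hA : ∀ a : Hfin ρ μ q, IsAtom ρ μ q a → ‖T a‖ ≤ A) :
    ∃ S : H1 ρ μ q →ₗ[ℂ] Lp ℂ 1 μ, S ∘ₗ Submodule.inclusion (Hfin_le_H1 ρ μ q) = T ∧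
      ∀ (g : H1 ρ μ q) c a (h : IsAtomicDecomp ρ μ q g c a),
        HasSum (fun j => c j • T ⟨a j, Submodule.subset_span (h.atom j)⟩) (S g) := by
  have hex : ∀ g : H1 ρ μ q, ∃ t, IsSumOfImages T g t := fun g => by
    obtain ⟨c, a, h⟩ := g.2
    exact ⟨_, c, a, h, (summable_smul_apply_atoms hA h).hasSum⟩
  choose S hS using hex
  refine ⟨{ toFun := S
            map_add' := fun f g => (hS (f + g)).unique hT ((hS f).add (hS g))
            map_smul' := fun z f => (hS (z • f)).unique hT ((hS f).smul z) }, ?_, ?_⟩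
  · ext1 f
    exact (hS (Submodule.inclusion (Hfin_le_H1 ρ μ q) f)).eq_apply hT
  · intro g c a h
    have hs := (summable_smul_apply_atoms hA h).hasSum
    have e : S g = _ := (hS g).unique hT ⟨c, a, h, hs⟩
    change HasSum _ (S g)
    rwa [e]

theorem norm_apply_le_mul_h1Norm [Nonempty M] {T : Hfin ρ μ q →ₗ[ℂ] Lp ℂ 1 μ} {A : ℝ}
    (hA : 0 ≤ A) (hT : ∀ a : Hfin ρ μ q, IsAtom ρ μ q a → ‖T a‖ ≤ A)
    {S : H1 ρ μ q →ₗ[ℂ] Lp ℂ 1 μ}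
    (hS : ∀ (g : H1 ρ μ q) c a (h : IsAtomicDecomp ρ μ q g c a),
      HasSum (fun j => c j • T ⟨a j, Submodule.subset_span (h.atom j)⟩) (S g)) (g : H1 ρ μ q) :
    ‖S g‖ ≤ A * h1Norm ρ μ q g := by
  refine le_mul_h1Norm g.2 hA fun c a h => ?_
  refine (hS g c a h).norm_le_of_bounded (h.summable.hasSum.mul_left A) fun j => ?_
  rw [norm_smul, mul_comm]
  gcongr
  exact hT _ (h.atom j)

/-- The main estimate for operators, by duality from `norm_apply_le_of_decomp`. -/
theorem norm_map_le_of_decomp [Nonempty M] (hM : IsHomogeneousType ρ μ)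
    (hq : 1 < q) (hq' : q < ∞) (T : Hfin ρ μ q →ₗ[ℂ] Lp ℂ 1 μ) {A : ℝ} (hA : 0 ≤ A)
    (hT : ∀ a : Hfin ρ μ q, IsAtom ρ μ q a → ‖T a‖ ≤ A) (g : Hfin ρ μ q) (c : ℕ → ℂ)
    (a : ℕ → Lp ℂ 1 μ) (h : IsAtomicDecomp ρ μ q g c a) : ‖T g‖ ≤ 2 * A * ∑' j, ‖c j‖ := by
  obtain ⟨F, hF, hFg⟩ := exists_dual_vector'' ℂ (T g)
  have h1 := norm_apply_le_of_decomp hM hq hq' ((F : Lp ℂ 1 μ →ₗ[ℂ] ℂ) ∘ₗ T) hA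
    (fun a ha => by
      refine (F.le_of_opNorm_le hF _).trans ?_
      rw [one_mul]
      exact hT a ha) h
  have h2 : ‖F (T g)‖ = ‖T g‖ := by rw [hFg]; simp
  rw [← h2]
  exact h1

/-- Every bounded extension is given by summing the images of the atoms. -/
theorem IsBoundedExtension.hasSum [Nonempty M] {T : Hfin ρ μ q →ₗ[ℂ] Lp ℂ 1 μ}
    {S : H1 ρ μ q →ₗ[ℂ] Lp ℂ 1 μ} (hS : IsBoundedExtension ρ μ q T S) {g : H1 ρ μ q} {c : ℕ → ℂ}
    {a : ℕ → Lp ℂ 1 μ} (h : IsAtomicDecomp ρ μ q g c a) :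
    HasSum (fun j => c j • T ⟨a j, Submodule.subset_span (h.atom j)⟩) (S g) := by
  obtain ⟨⟨C, hC⟩, rfl⟩ := hS
  refine hasSum_apply_atoms (V := H1 ρ μ q) (C := |C|)
    (fun b hb => Hfin_le_H1 ρ μ q (Submodule.subset_span hb)) S (fun f c a hd => ?_) h
  calc ‖S f‖ ≤ C * h1Norm ρ μ q f := hC f
    _ ≤ |C| * h1Norm ρ μ q f := by
        gcongr
        · exact h1Norm_nonneg _
        · exact le_abs_self C
    _ ≤ |C| * ∑' j, ‖c j‖ := by gcongr; exact hd.h1Norm_le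

end AtomicHardy

theorem theorem4p1 {M : Type*} [Nonempty M] [MeasurableSpace M] (ρ : M → M → ℝ)
    (μ : Measure M) [SigmaFinite μ] (hM : AtomicHardy.IsHomogeneousType ρ μ)
    (hμ : μ Set.univ = ∞) (q : ℝ≥0∞) (hq : 1 < q) (hq' : q < ∞)
    (T : AtomicHardy.Hfin ρ μ q →ₗ[ℂ] Lp ℂ 1 μ)
    (hT : BddAbove (AtomicHardy.atomNorms ρ μ q T)) :
    (∃! S : AtomicHardy.H1 ρ μ q →ₗ[ℂ] Lp ℂ 1 μ,
      AtomicHardy.IsBoundedExtension ρ μ q T S) ∧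
    ∀ S : AtomicHardy.H1 ρ μ q →ₗ[ℂ] Lp ℂ 1 μ,
      AtomicHardy.IsBoundedExtension ρ μ q T S →
        ∀ g, ‖S g‖ ≤ 2 * sSup (AtomicHardy.atomNorms ρ μ q T) *
          AtomicHardy.h1Norm ρ μ q g := by
  open AtomicHardy in
  set A := sSup (atomNorms ρ μ q T) with hAdef
  have hA : 0 ≤ A := Real.sSup_nonneg (by rintro _ ⟨a, _, rfl⟩; exact norm_nonneg _)
  have hTA : ∀ a : Hfin ρ μ q, IsAtom ρ μ q a → ‖T a‖ ≤ A := fun a ha =>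
    le_csSup hT ⟨a, ha, rfl⟩
  have hTd := norm_map_le_of_decomp hM hq hq' T hA hTA
  refine ⟨?_, fun S hS g => ?_⟩
  · obtain ⟨S, hST, hS⟩ := exists_extension hTd hTA
    refine ⟨S, ⟨⟨A, norm_apply_le_mul_h1Norm hA hTA hS⟩, hST⟩, fun S' hS' => ?_⟩
    ext1 g
    obtain ⟨c, a, h⟩ := g.2
    exact (hS'.hasSum h).unique (hS g c a h)
  · have hg := norm_apply_le_mul_h1Norm hA hTA (fun g c a h => hS.hasSum h) g
    refine hg.trans ?_
    gcongr
    · exact h1Norm_nonneg _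
    · linarith
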